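/- **Setup.** Let $\nu$ be a probability measure on a measurable space $\mathcal Z$, let $\ell(z,h)$ be a real-valued bounded loss of a model $h$ at an observation $z$, and let $\lambda_1,\dots,\lambda_J$ be hyperparameter configurations. For each $j$ let $g_{\lambda_j}$ be an inducer, i.e. a map from finite data sets (of any size) to models, which is invariant to the ordering of the data set, with $(z,T)\mapsto \ell(z,g_{\lambda_j}(T))$ measurable. Write $R(h)=\mathbb E[\ell(Z,h)]$ with $Z\sim\nu$, and let $\mathcal T_n=(Z_1,\dots,Z_n)$ and $Z,Z',Z_n'$ be i.i.d. from $\nu$, and $\mathcal T_n'$ be $\mathcal T_n$ with $Z_n$ replaced by $Z_n'$. Put $$\tilde\ell_n(z,\lambda;\mathcal T)=\ell(z,g_\lambda(\mathcal T))-R(g_\lambda(\mathcal T)),\quad \bar\ell_n(z,\lambda)=\mathbb E[\ell(z,g_\lambda(\mathcal T_n))]-\mathbb E[\ell(Z,g_\lambda(\mathcal T_n))],\quad \mu(\lambda)=\mu_n(\lambda)=\mathbb E[\ell(Z,g_\lambda(\mathcal T_n))].$$ Assume 1. (loss stability) $\max_j\mathbb E\big[(\tilde\ell_n(Z,\lambda_j;\mathcal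 T_n)-\tilde\ell_n(Z,\lambda_j;\mathcal T_n'))^2\big]=o(1/n)$; 2. (risk stability) for every $j$ there is a fixed prediction rule $g^*_{\lambda_j}$ with $\max_j\mathbb E\,|R(g_{\lambda_j}(\mathcal T_n))-R(g^*_{\lambda_j})|=o(1/\sqrt n)$; 3. the limits $K(\lambda_i,\lambda_j)=\lim_{n\to\infty}\operatorname{Cov}[\bar\ell_n(Z',\lambda_i),\bar\ell_n(Z',\lambda_j)]$ exist. **Resampling.** Let $\alpha\in(0,1)$ and $M\ge1$, and let $n\to\infty$ through an infinite set $S$ of sample sizes (for instance all $n$, or all multiples of $M$). For each $n$ let $\mathcal D=(Z_1,\dots,Z_n)$ be i.i.d. from $\nu$ and let $\mathcal I_{m,j}\subset\{1,\dots,n\}$, $m\le M$, $j\le J$, be random validation index sets, jointly independent of $\mathcal D$; for $n\in S$ let $|\mathcal I_{m,j}|=\lceil\alpha n\rceil$ almost surely. Assume that for all $i,j$ the limit $$\tau_{i,j,M}=\lim_{n\to\infty,\,n\in S}\frac1{nM^2\alpha^2}\sum_{s=1}^n\sum_{m=1}^M\sum_{m'=1}^M\Pr(s\in\mathcal I_{m,i}\cap\mathcal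 I_{m',j})$$ exists, and that the overlaps of the validation sets concentrate: $$\operatorname{Var}\Big[\frac1n\sum_{m=1}^M\sum_{m'=1}^M|\mathcal I_{m,i}\cap\mathcal I_{m',j}|\Big]\to0\qquad(n\to\infty,\ n\in S).$$ Let $$\hat\mu(\lambda_j)=\frac1M\sum_{m=1}^M\frac1{|\mathcal I_{m,j}|}\sum_{i\in\mathcal I_{m,j}}\ell\big(Z_i,g_{\lambda_j}(\{Z_k\}_{k\notin\mathcal I_{m,j}})\big).$$ **Theorem.** The matrix $\Sigma_{ij}=\tau_{i,j,M}\,K(\lambda_i,\lambda_j)$ is positive semidefinite and, as $n\to\infty$ through $S$, $$\sqrt n\,\big(\hat\mu(\lambda_j)-\mu(\lambda_j)\big)_{j=1}^J\to\mathcal N(0,\Sigma)\quad\text{in distribution.}$$ -/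

import Mathlib

open MeasureTheory ProbabilityTheory Filter Topology Asymptotics
open scoped BigOperators

namespace Resampling

variable {𝒵 H : Type*}

/-- An inducer (for one hyperparameter configuration): it maps a data set of any finite size,
given as a tuple, to a model. -/
abbrev Inducer (𝒵 H : Type*) : Type _ := (n : ℕ) → (Fin n → 𝒵) → H

/-- The inducer does not depend on the ordering of the data set. -/
def Inducer.PermInvariant (g : Inducer 𝒵 H) : Prop :=
  ∀ (n : ℕ) (T : Fin n → 𝒵) (σ : Equiv.Perm (Fin n)), g n (T ∘ σ) = g n T

/-- The model fitted on the observations with index outside of `V` (listed in increasing order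
of their index). -/
def fitOutside {n : ℕ} (g : Inducer 𝒵 H) (z : Fin n → 𝒵) (V : Finset (Fin n)) : H :=
  g Vᶜ.card (fun k => z (Vᶜ.orderEmbOfFin rfl k))

/-- The average loss over the validation set `V` of the model trained on the complement of `V`. -/
noncomputable def foldLoss {n : ℕ} (ℓ : 𝒵 → H → ℝ) (g : Inducer 𝒵 H) (z : Fin n → 𝒵)
    (V : Finset (Fin n)) : ℝ :=
  (1 / (V.card : ℝ)) * ∑ i ∈ V, ℓ (z i) (fitOutside g z V)

/-- The `M`-fold validation loss with validation index sets `V 0, …, V (M - 1)`. -/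
noncomputable def validationLoss {n M : ℕ} (ℓ : 𝒵 → H → ℝ) (g : Inducer 𝒵 H) (z : Fin n → 𝒵)
    (V : Fin M → Finset (Fin n)) : ℝ :=
  (1 / (M : ℝ)) * ∑ m, foldLoss ℓ g z (V m)

/-- The total overlap `∑_{m, m'} |A m ∩ B m'|` of two families of validation index sets. -/
def overlap {n M : ℕ} (A B : Fin M → Finset (Fin n)) : ℕ :=
  ∑ m, ∑ m', (A m ∩ B m').card

/-- The data set `T` with its last observation replaced by `z'`. -/
def replaceLast {n : ℕ} (T : Fin n → 𝒵) (z' : 𝒵) : Fin n → 𝒵 :=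
  fun i => if (i : ℕ) + 1 = n then z' else T i

variable [MeasurableSpace 𝒵]

/-- The law of an i.i.d. sample of size `n` from `ν`. -/
noncomputable abbrev sampleLaw (ν : Measure 𝒵) (n : ℕ) : Measure (Fin n → 𝒵) :=
  Measure.pi (fun _ : Fin n => ν)

/-- The risk `R(h) = E[ℓ(Z, h)]` of a fixed model `h`, where `Z` has law `ν`. -/
noncomputable def risk (ν : Measure 𝒵) (ℓ : 𝒵 → H → ℝ) (h : H) : ℝ :=
  ∫ z, ℓ z h ∂ν

/-- The expected generalization error `μ = E[ℓ(Z, g(T))]`, for `T` an i.i.d. sample of size `n` and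
`Z` a fresh observation independent of `T`. -/
noncomputable def expectedRisk (ν : Measure 𝒵) (ℓ : 𝒵 → H → ℝ) (g : Inducer 𝒵 H) (n : ℕ) : ℝ :=
  ∫ T, risk ν ℓ (g n T) ∂(sampleLaw ν n)

/-- The loss at `z` of the model trained on `T`, centered at its conditional expectation given `T`:
`ℓ(z, g(T)) - E[ℓ(Z, g(T)) | T]`. -/
noncomputable def centeredLoss (ν : Measure 𝒵) (ℓ : 𝒵 → H → ℝ) (g : Inducer 𝒵 H) {n : ℕ}
    (z : 𝒵) (T : Fin n → 𝒵) : ℝ :=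
  ℓ z (g n T) - risk ν ℓ (g n T)

/-- The mean squared change of the centered loss at a fresh observation `Z`, when the last of `n`
training points is replaced by an independent copy. The variable of integration is
`p = (T, z', z)`. -/
noncomputable def lossInstability (ν : Measure 𝒵) (ℓ : 𝒵 → H → ℝ) (g : Inducer 𝒵 H) (n : ℕ) : ℝ :=
  ∫ p : (Fin n → 𝒵) × 𝒵 × 𝒵,
    (centeredLoss ν ℓ g p.2.2 p.1 - centeredLoss ν ℓ g p.2.2 (replaceLast p.1 p.2.1)) ^ 2
    ∂((sampleLaw ν n).prod (ν.prod ν))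

/-- The centered pointwise loss `E[ℓ(z, g(T))] - E[ℓ(Z, g(T))]`, with `T` an i.i.d. sample of
size `n`. -/
noncomputable def pointwiseLoss (ν : Measure 𝒵) (ℓ : 𝒵 → H → ℝ) (g : Inducer 𝒵 H) (n : ℕ)
    (z : 𝒵) : ℝ :=
  (∫ T, ℓ z (g n T) ∂(sampleLaw ν n)) - expectedRisk ν ℓ g n

/-- Loss stability: the mean squared change of the centered loss is `o(1/n)`. -/
def LossStable (ν : Measure 𝒵) (ℓ : 𝒵 → H → ℝ) (g : Inducer 𝒵 H) : Prop :=
  (fun n : ℕ => lossInstability ν ℓ g n) =o[atTop] (fun n : ℕ => 1 / (n : ℝ))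

/-- Risk stability: the risk of the fitted model converges in mean to the risk of a fixed
prediction rule, at the rate `o(1/√n)`. -/
def RiskStable (ν : Measure 𝒵) (ℓ : 𝒵 → H → ℝ) (g : Inducer 𝒵 H) : Prop :=
  ∃ gstar : H, Measurable (fun z => ℓ z gstar) ∧
    (fun n : ℕ => ∫ T, |risk ν ℓ (g n T) - risk ν ℓ gstar| ∂(sampleLaw ν n))
      =o[atTop] (fun n : ℕ => 1 / Real.sqrt n)

end Resampling

/-! Fix the validation sets, each of size `v = ⌈αn⌉`, and let `T` be the training sample of a fold.
At a validation point `z`, the loss minus `μ_n` splits into three pieces: the deviation of the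
centered loss from its mean over training samples, the pointwise loss `\bar ℓ_{n-v}(z)`, and the
risk fluctuation `R(g(T)) - μ_n`.

The deviations at distinct validation points of one fold are orthogonal, since given `T` they are
independent and centered. The Efron-Stein inequality bounds each second moment by `(n-v)/2` times
the loss instability, which is `o(1)`. Their fold average is thus `o(1/√n)` in mean
(`integral_abs_foldLoss_sub_le`). Risk stability, used at sizes `n - v` and `n`, makes the third
piece `o(1/√n)` as well.

What remains is a weighted sum of `\bar ℓ_{n-v}(Z_s)` over the observations `s`, the weight being
the number of times `s` is used for validation, divided by `Mv`. For a linear functional `t` the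
scaled summands are independent, centered and `O(1/√n)`, so the characteristic function is within
`o(1)` of `exp(-V/2)`, where `V` is the variance given the validation sets
(`norm_integral_exp_scaledError_sub_le`). `V` depends on these sets only through their overlaps, and
the concentration of the overlaps gives `V → tᵀΣt` in mean (`integral_abs_linearVariance_sub_le`).

Averaging over the validation sets, which are independent of the data, and using that `x ↦
exp(-x/2)` is Lipschitz on `x ≥ 0` yields the Gaussian characteristic function; Lévy's continuity
theorem concludes. `Σ` is positive semidefinite because `tᵀΣt` is a limit of expected variances. -/

namespace Resampling

/-! ### Product measures and the Efron-Stein inequality -/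

section ProductMeasure

section Swap

variable {ι E : Type*} [DecidableEq ι]

/-- Exchange the two entries of the pairs with index in `A`. -/
def swapOn (A : Finset ι) (w : ι → E × E) : ι → E × E :=
  fun i => if i ∈ A then (w i).swap else w i


theorem swapOn_empty (w : ι → E × E) : swapOn ∅ w = w := by
  ext1 i; simp [swapOn]

theorem swapOn_swapOn_singleton {A : Finset ι} {k : ι} (hk : k ∉ A) (w : ι → E × E) :
    swapOn A (swapOn {k} w) = swapOn (insert k A) w := by
  ext1 i
  by_cases h : i = k
  · subst h; simp [swapOn, hk]
  · simp [swapOn, h]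

theorem swapOn_singleton_swapOn {A : Finset ι} {k : ι} (hk : k ∉ A) (w : ι → E × E) :
    swapOn {k} (swapOn A w) = swapOn (insert k A) w := by
  ext1 i
  by_cases h : i = k
  · subst h; simp [swapOn, hk]
  · simp [swapOn, h]

end Swap

variable {ι κ E : Type*} [Fintype ι] [Fintype κ] [MeasurableSpace E]
  (ν : Measure E) [IsProbabilityMeasure ν]

/-- Resampling one coordinate does not change the law of an i.i.d. family. -/
theorem measurePreserving_update [DecidableEq ι] (i : ι) :
    MeasurePreserving (fun p : (ι → E) × E => Function.update p.1 i p.2)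
      ((Measure.pi fun _ : ι => ν).prod ν) (Measure.pi fun _ : ι => ν) := by
  have hm : Measurable (fun p : (ι → E) × E => Function.update p.1 i p.2) := by
    refine measurable_pi_lambda _ fun j => ?_
    by_cases h : j = i
    · subst h; simpa using measurable_snd
    · simp only [Function.update_of_ne h]; fun_prop
  refine ⟨hm, ?_⟩
  refine (Measure.pi_eq fun s hs => ?_).symm
  rw [Measure.map_apply hm (MeasurableSet.univ_pi hs)]
  have : (fun p : (ι → E) × E => Function.update p.1 i p.2) ⁻¹' (Set.univ.pi s)
      = (Set.univ.pi (Function.update s i Set.univ)) ×ˢ s i := by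
    ext p
    simp only [Set.mem_preimage, Set.mem_univ_pi, Set.mem_prod]
    constructor
    · intro h
      refine ⟨fun j => ?_, by simpa using h i⟩
      by_cases hj : j = i
      · subst hj; simp
      · simpa [Function.update_of_ne hj] using h j
    · rintro ⟨h, hi⟩ j
      by_cases hj : j = i
      · subst hj; simpa using hi
      · simpa [Function.update_of_ne hj] using h j
  rw [this, Measure.prod_prod, Measure.pi_pi, ← Finset.prod_erase_mul _ _ (Finset.mem_univ i),
    ← Finset.prod_erase_mul (a := i) _ _ (Finset.mem_univ i)]
  simp only [Function.update_self, measure_univ, mul_one]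
  congr 1
  refine Finset.prod_congr rfl fun j hj => ?_
  rw [Function.update_of_ne (Finset.ne_of_mem_erase hj)]

/-- Selecting distinct coordinates of an i.i.d. family gives an i.i.d. family. -/
theorem measurePreserving_comp_injective {e : κ → ι} (he : Function.Injective e) :
    MeasurePreserving (fun z : ι → E => fun k => z (e k))
      (Measure.pi fun _ : ι => ν) (Measure.pi fun _ : κ => ν) := by
  have hm : Measurable (fun z : ι → E => fun k => z (e k)) := by fun_prop
  refine ⟨hm, ?_⟩
  have h1 : iIndepFun (fun (i : ι) (z : ι → E) => z i) (Measure.pi fun _ : ι => ν) :=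
    iIndepFun_pi (X := fun _ x => x) (fun _ => aemeasurable_id)
  have h2 := h1.precomp he
  rw [iIndepFun_iff_map_fun_eq_pi_map (fun k => (measurable_pi_apply _).aemeasurable)] at h2
  rw [h2]
  congr 1
  ext1 k
  exact (measurePreserving_eval (fun _ : ι => ν) (e k)).map_eq

theorem integrable_of_bounded {Ω : Type*} [MeasurableSpace Ω] {μ : Measure Ω} [IsFiniteMeasure μ]
    {f : Ω → ℝ} (hf : Measurable f) {C : ℝ} (hC : ∀ x, |f x| ≤ C) : Integrable f μ :=
  Integrable.of_bound hf.aestronglyMeasurable C (.of_forall hC)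

theorem abs_integral_le_of_bounded {Ω : Type*} [MeasurableSpace Ω] {μ : Measure Ω}
    [IsProbabilityMeasure μ] {f : Ω → ℝ} {C : ℝ} (hC : ∀ x, |f x| ≤ C) : |∫ x, f x ∂μ| ≤ C := by
  have := norm_integral_le_of_norm_le_const (μ := μ) (f := f) (.of_forall hC)
  simpa using this

theorem integral_comp_eq {Ω Ω' : Type*} [MeasurableSpace Ω] [MeasurableSpace Ω'] {μ : Measure Ω}
    {μ' : Measure Ω'} {φ : Ω → Ω'} (hφ : MeasurePreserving φ μ μ') {f : Ω' → ℝ}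
    (hf : Measurable f) : ∫ x, f (φ x) ∂μ = ∫ y, f y ∂μ' := by
  rw [← hφ.map_eq, integral_map hφ.aemeasurable hf.aestronglyMeasurable]

section EfronStein

variable [DecidableEq ι]

theorem measurePreserving_swapOn (A : Finset ι) :
    MeasurePreserving (swapOn (E := E) A) (Measure.pi fun _ : ι => ν.prod ν)
      (Measure.pi fun _ : ι => ν.prod ν) := by
  have := measurePreserving_pi (fun _ : ι => ν.prod ν) (fun _ : ι => ν.prod ν)
    (f := fun i p => if i ∈ A then p.swap else p) (fun i => by
      by_cases h : i ∈ A
      · simpa [h] using Measure.measurePreserving_swap (μ := ν) (ν := ν)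
      · simp only [h, if_false]; exact MeasurePreserving.id (ν.prod ν))
  exact this

/-- Coordinates are swapped one at a time. Swapping coordinate `k` preserves the law and flips the
sign of the increment it causes, so the mean of `F` times the increment is half the mean of `(F - F
∘ swapOn {k})` times the increment. Then `ab ≤ (a² + b²)/2` applies, and both squares have the same
mean. -/
theorem integral_mul_sub_swapOn_le {F : (ι → E × E) → ℝ} (hF : Measurable F) {B : ℝ}
    (hB : ∀ w, |F w| ≤ B) (A : Finset ι) :
    ∫ w, F w * (F w - F (swapOn A w)) ∂(Measure.pi fun _ : ι => ν.prod ν)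
      ≤ (1 / 2) * ∑ k ∈ A,
        ∫ w, (F w - F (swapOn {k} w)) ^ 2 ∂(Measure.pi fun _ : ι => ν.prod ν) := by
  set Q := (Measure.pi fun _ : ι => ν.prod ν) with hQ
  have hs (A : Finset ι) : MeasurePreserving (swapOn A) Q Q := measurePreserving_swapOn ν A
  have hms (A : Finset ι) : Measurable (fun w => F (swapOn A w)) := hF.comp (hs A).measurable
  have hbd {x y : ℝ} (hx : |x| ≤ B) (hy : |y| ≤ 2 * B) : |x * y| ≤ B * (2 * B) := by
    rw [abs_mul]; exact mul_le_mul hx hy (abs_nonneg _) ((abs_nonneg _).trans hx)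
  have hsub (w w') : |F w - F w'| ≤ 2 * B := by
    have := abs_sub (F w) (F w'); linarith [hB w, hB w']
  induction A using Finset.induction_on with
  | empty => simp [swapOn_empty]
  | insert k A hk ih =>
    rw [Finset.sum_insert hk]
    have hi1 : Integrable (fun w => F w * (F w - F (swapOn A w))) Q :=
      integrable_of_bounded (hF.mul (hF.sub (hms A))) fun w => hbd (hB w) (hsub _ _)
    have hi2 : Integrable (fun w => F w * (F (swapOn A w) - F (swapOn (insert k A) w))) Q :=
      integrable_of_bounded (hF.mul ((hms A).sub (hms _))) fun w => hbd (hB w) (hsub _ _)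
    have hi3 : Integrable (fun w => F (swapOn {k} w) *
        (F (swapOn A w) - F (swapOn (insert k A) w))) Q :=
      integrable_of_bounded ((hms {k}).mul ((hms A).sub (hms _))) fun w => hbd (hB _) (hsub _ _)
    have hsq (A A' : Finset ι) : Integrable (fun w => (F (swapOn A w) - F (swapOn A' w)) ^ 2) Q := by
      refine integrable_of_bounded (((hms A).sub (hms A')).pow_const 2) (C := (2 * B) ^ 2) fun w => ?_
      rw [abs_pow]; exact pow_le_pow_left₀ (abs_nonneg _) (hsub _ _) 2
    have hsq0 (A : Finset ι) : Integrable (fun w => (F w - F (swapOn A w)) ^ 2) Q := by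
      simpa only [swapOn_empty] using hsq ∅ A
    have e1 : ∫ w, F w * (F w - F (swapOn (insert k A) w)) ∂Q
        = ∫ w, F w * (F w - F (swapOn A w)) ∂Q
          + ∫ w, F w * (F (swapOn A w) - F (swapOn (insert k A) w)) ∂Q := by
      rw [← integral_add hi1 hi2]; congr 1; ext w; ring
    -- Substituting `swapOn {k} w` for `w` exchanges the two terms of the increment.
    have e2 : ∫ w, F w * (F (swapOn A w) - F (swapOn (insert k A) w)) ∂Q
        = - ∫ w, F (swapOn {k} w) * (F (swapOn A w) - F (swapOn (insert k A) w)) ∂Q := by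
      rw [← integral_neg]
      refine (integral_comp_eq (hs {k}) (hF.mul ((hms A).sub (hms _)))).symm.trans ?_
      congr 1; ext w
      have : swapOn (insert k A) (swapOn {k} w) = swapOn A w := by
        ext1 i
        by_cases h : i = k
        · subst h; simp [swapOn, hk]
        · simp [swapOn, h]
      simp only [Pi.mul_apply, Pi.sub_apply, swapOn_swapOn_singleton hk, this]
      ring
    have e3 : ∫ w, (F (swapOn A w) - F (swapOn (insert k A) w)) ^ 2 ∂Q
        = ∫ w, (F w - F (swapOn {k} w)) ^ 2 ∂Q := by
      refine Eq.trans ?_ (integral_comp_eq (hs A) ((hF.sub (hms {k})).pow_const 2))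
      simp only [swapOn_singleton_swapOn hk]
    have e4 : ∫ w, F w * (F (swapOn A w) - F (swapOn (insert k A) w)) ∂Q
        = (1 / 2) * ∫ w, (F w - F (swapOn {k} w)) *
            (F (swapOn A w) - F (swapOn (insert k A) w)) ∂Q := by
      simp_rw [sub_mul (F _) (F (swapOn {k} _))]
      rw [integral_sub hi2 hi3]; linarith
    have e5 : ∫ w, (F w - F (swapOn {k} w)) * (F (swapOn A w) - F (swapOn (insert k A) w)) ∂Q
        ≤ ∫ w, ((F w - F (swapOn {k} w)) ^ 2 / 2
          + (F (swapOn A w) - F (swapOn (insert k A) w)) ^ 2 / 2) ∂Q := by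
      refine integral_mono ?_ (((hsq0 _).div_const 2).add ((hsq _ _).div_const 2)) fun w => ?_
      · simp_rw [sub_mul (F _) (F (swapOn {k} _))]
        exact hi2.sub hi3
      · dsimp only
        nlinarith [sq_nonneg ((F w - F (swapOn {k} w)) - (F (swapOn A w) - F (swapOn (insert k A) w)))]
    rw [integral_add ((hsq0 _).div_const 2) ((hsq _ _).div_const 2), integral_div, integral_div, e3]
      at e5
    linarith

/-- The Efron-Stein inequality, for a bounded function of an i.i.d. family. -/
theorem integral_sub_integral_sq_le_sum {f : (ι → E) → ℝ} (hf : Measurable f) {B : ℝ}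
    (hB : ∀ T, |f T| ≤ B) :
    ∫ T, (f T - ∫ T', f T' ∂(Measure.pi fun _ : ι => ν)) ^ 2 ∂(Measure.pi fun _ : ι => ν)
      ≤ (1 / 2) * ∑ k, ∫ p : (ι → E) × E, (f p.1 - f (Function.update p.1 k p.2)) ^ 2
        ∂((Measure.pi fun _ : ι => ν).prod ν) := by
  set P := (Measure.pi fun _ : ι => ν) with hP
  set Q := (Measure.pi fun _ : ι => ν.prod ν) with hQ
  have hpair : MeasurePreserving (MeasurableEquiv.arrowProdEquivProdArrow E E ι) Q (P.prod P) :=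
    measurePreserving_arrowProdEquivProdArrow E E ι (fun _ => ν) (fun _ => ν)
  have hfst : MeasurePreserving (fun w : ι → E × E => fun i => (w i).1) Q P :=
    measurePreserving_fst.comp hpair
  set F : (ι → E × E) → ℝ := fun w => f (fun i => (w i).1) with hFdef
  have hF : Measurable F := hf.comp hfst.measurable
  have key := integral_mul_sub_swapOn_le ν hF (fun w => hB _) Finset.univ
  have hfi : Integrable f P := integrable_of_bounded hf hB
  have hB2 (T T') : |f T * f T'| ≤ B * B := by
    rw [abs_mul]; exact mul_le_mul (hB _) (hB _) (abs_nonneg _) ((abs_nonneg _).trans (hB T))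
  have hff : Integrable (fun T => f T * f T) P := integrable_of_bounded (hf.mul hf) fun T => hB2 T T
  -- `F` reads the first entries only, so swapping every pair replaces the sample by an independent
  -- copy; the integral is then `E[f²] - (E f)²`.
  have hlhs : ∫ w, F w * (F w - F (swapOn Finset.univ w)) ∂Q
      = ∫ T, (f T - ∫ T', f T' ∂P) ^ 2 ∂P := by
    have h1 : ∫ w, F w * F w ∂Q = ∫ T, f T * f T ∂P := by
      rw [← hfst.map_eq, integral_map hfst.aemeasurable]
      exact (hf.mul hf).aestronglyMeasurable
    have h2 : ∫ w, F w * F (swapOn Finset.univ w) ∂Q = (∫ T, f T ∂P) * ∫ T, f T ∂P := by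
      rw [← integral_prod_mul, ← hpair.map_eq, integral_map hpair.aemeasurable]
      · simp [hFdef, swapOn, MeasurableEquiv.arrowProdEquivProdArrow,
          Equiv.arrowProdEquivProdArrow]
      · exact ((hf.comp measurable_fst).mul (hf.comp measurable_snd)).aestronglyMeasurable
    have hms : Measurable fun w => F (swapOn Finset.univ w) :=
      hF.comp (measurePreserving_swapOn ν Finset.univ).measurable
    simp_rw [mul_sub]
    rw [integral_sub, h1, h2]
    · simp_rw [sub_sq]
      rw [integral_add, integral_sub, integral_const, integral_mul_const, integral_const_mul]
      · simp [pow_two]; ring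
      · simpa [pow_two] using hff
      · exact (hfi.const_mul 2).mul_const _
      · exact (by simpa [pow_two] using hff : Integrable (fun T => f T ^ 2) P).sub
          ((hfi.const_mul 2).mul_const _)
      · exact integrable_const _
    · exact integrable_of_bounded (hF.mul hF) fun w => hB2 _ _
    · exact integrable_of_bounded (hF.mul hms) fun w => hB2 _ _
  rw [hlhs] at key
  refine key.trans_eq ?_
  congr 1
  refine Finset.sum_congr rfl fun k _ => ?_
  have hk : MeasurePreserving (fun w : ι → E × E => ((fun i => (w i).1), (w k).2)) Q (P.prod ν) :=
    ((MeasurePreserving.id P).prod (measurePreserving_eval (fun _ : ι => ν) k)).comp hpair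
  have hu := (measurePreserving_update ν k).measurable
  rw [← hk.map_eq, integral_map hk.aemeasurable]
  · congr 1; ext w
    congr 3
    simp only [hFdef]
    congr 1
    ext i
    by_cases h : i = k
    · subst h; simp [swapOn]
    · simp [swapOn, h]
  · exact (((hf.comp measurable_fst).sub (hf.comp hu)).pow_const 2).aestronglyMeasurable

end EfronStein

end ProductMeasure

/-! ### Gaussian approximation of characteristic functions -/

section CharacteristicFunction

/-- Factors are exchanged one at a time, as in Lindeberg's method; the other factors have norm at
most `1`. -/
theorem norm_prod_sub_prod_le {ι : Type*} (s : Finset ι) (a b : ι → ℂ) (ha : ∀ i, ‖a i‖ ≤ 1)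
    (hb : ∀ i, ‖b i‖ ≤ 1) : ‖∏ i ∈ s, a i - ∏ i ∈ s, b i‖ ≤ ∑ i ∈ s, ‖a i - b i‖ := by
  classical
  induction s using Finset.induction_on with
  | empty => simp
  | insert k s hk ih =>
    rw [Finset.prod_insert hk, Finset.prod_insert hk, Finset.sum_insert hk]
    have hp : ‖∏ i ∈ s, b i‖ ≤ 1 := by
      rw [norm_prod]; exact Finset.prod_le_one (fun _ _ => norm_nonneg _) fun i _ => hb i
    have e : a k * ∏ i ∈ s, a i - b k * ∏ i ∈ s, b i
        = a k * (∏ i ∈ s, a i - ∏ i ∈ s, b i) + (a k - b k) * ∏ i ∈ s, b i := by ring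
    rw [e]
    refine (norm_add_le _ _).trans ?_
    rw [norm_mul, norm_mul]
    have h1 := mul_le_mul (ha k) ih (norm_nonneg _) zero_le_one
    have h2 := mul_le_mul_of_nonneg_left hp (norm_nonneg (a k - b k))
    linarith

theorem norm_exp_I_sub_taylor_le {x : ℝ} (hx : |x| ≤ 1) :
    ‖Complex.exp (Complex.I * x) - (1 + Complex.I * x - (x : ℂ) ^ 2 / 2)‖ ≤ |x| ^ 3 := by
  have h : ‖Complex.I * (x : ℂ)‖ = |x| := by simp
  have := Complex.exp_bound (x := Complex.I * x) (by rw [h]; exact hx) (n := 3) (by norm_num)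
  rw [h] at this
  simp only [Finset.sum_range_succ, Finset.sum_range_zero] at this
  have e : (1 + Complex.I * x - (x : ℂ) ^ 2 / 2) = (0 + (Complex.I * x) ^ 0 / (Nat.factorial 0 : ℂ)
      + (Complex.I * x) ^ 1 / (Nat.factorial 1 : ℂ) + (Complex.I * x) ^ 2 / (Nat.factorial 2 : ℂ)) := by
    rw [mul_pow _ _ 2, Complex.I_sq]; simp; ring
  rw [e]
  refine this.trans ?_
  have h3 : 0 ≤ |x| ^ 3 := by positivity
  norm_num [Nat.factorial]
  linarith

theorem norm_exp_I_mul_le (x : ℝ) : ‖Complex.exp (Complex.I * x)‖ ≤ 1 := by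
  rw [Complex.norm_exp_I_mul_ofReal]

variable {E : Type*} [MeasurableSpace E] (ν : Measure E) [IsProbabilityMeasure ν]

/-- The Gaussian approximation of the characteristic function of a small centered variable. -/
theorem norm_integral_exp_sub_exp_le {h : E → ℝ} (hm : Measurable h) {ε : ℝ} (hε : ε ≤ 1)
    (hb : ∀ x, |h x| ≤ ε) (h0 : ∫ x, h x ∂ν = 0) :
    ‖∫ x, Complex.exp (Complex.I * h x) ∂ν - Complex.exp (-((∫ x, h x ^ 2 ∂ν : ℝ) : ℂ) / 2)‖
      ≤ 2 * ε ^ 3 := by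
  obtain ⟨x0⟩ : Nonempty E := by
    by_contra hne
    rw [not_nonempty_iff] at hne
    exact (IsProbabilityMeasure.ne_zero ν) (Measure.eq_zero_of_isEmpty ν)
  have hε0 : 0 ≤ ε := (abs_nonneg _).trans (hb x0)
  have hi : Integrable h ν := integrable_of_bounded hm hb
  have hi2 : Integrable (fun x => h x ^ 2) ν :=
    integrable_of_bounded (hm.pow_const 2) (C := ε ^ 2) fun x => by
      rw [abs_pow]; exact pow_le_pow_left₀ (abs_nonneg _) (hb x) 2
  have hie : Integrable (fun x => Complex.exp (Complex.I * h x)) ν :=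
    Integrable.of_bound (by fun_prop) 1 (.of_forall fun x => norm_exp_I_mul_le _)
  set v := ∫ x, h x ^ 2 ∂ν with hv
  have hv0 : 0 ≤ v := integral_nonneg fun x => sq_nonneg _
  have hv1 : v ≤ ε ^ 2 := by
    refine (le_abs_self _).trans (abs_integral_le_of_bounded fun x => ?_)
    rw [abs_pow]; exact pow_le_pow_left₀ (abs_nonneg _) (hb x) 2
  have hit : Integrable (fun x => (1 + Complex.I * h x - (h x : ℂ) ^ 2 / 2)) ν := by
    have := hi2.ofReal (𝕜 := ℂ)
    push_cast at this
    exact ((integrable_const _).add (hi.ofReal.const_mul _)).sub (this.div_const 2)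
  have hI : ∫ x, (1 + Complex.I * h x - (h x : ℂ) ^ 2 / 2) ∂ν = 1 - (v : ℂ) / 2 := by
    have h2 := hi2.ofReal (𝕜 := ℂ)
    have e2 : ∫ x, (h x : ℂ) ^ 2 ∂ν = (v : ℂ) := by
      rw [hv, ← integral_complex_ofReal]; simp
    have e1 : ∫ x, (h x : ℂ) ∂ν = 0 := by rw [integral_complex_ofReal, h0]; simp
    push_cast at h2
    rw [integral_sub, integral_add, integral_const_mul, e1, integral_div, e2]
    · simp
    · exact integrable_const _
    · exact hi.ofReal.const_mul _
    · exact (integrable_const _).add (hi.ofReal.const_mul _)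
    · exact h2.div_const 2
  have b1 : ‖∫ x, Complex.exp (Complex.I * h x) ∂ν - (1 - (v : ℂ) / 2)‖ ≤ ε ^ 3 := by
    rw [← hI, ← integral_sub hie hit]
    have := norm_integral_le_of_norm_le_const (μ := ν) (C := ε ^ 3)
      (f := fun x => Complex.exp (Complex.I * h x) - (1 + Complex.I * h x - (h x : ℂ) ^ 2 / 2))
      (.of_forall fun x => (norm_exp_I_sub_taylor_le ((hb x).trans hε)).trans
        (pow_le_pow_left₀ (abs_nonneg _) (hb x) 3))
    simpa using this
  -- The exponential remainder is at most `(v/2)² ≤ ε⁴`, which is at most `ε³` because `ε ≤ 1`.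
  have b2 : ‖(1 - (v : ℂ) / 2) - Complex.exp (-(v : ℂ) / 2)‖ ≤ ε ^ 3 := by
    have hε2 : ε ^ 2 ≤ 1 := pow_le_one₀ hε0 hε
    have e : ‖-(v : ℂ) / 2‖ = v / 2 := by
      rw [norm_div, norm_neg, Complex.norm_real, Real.norm_of_nonneg hv0]; simp
    have := Complex.norm_exp_sub_one_sub_id_le (x := -(v : ℂ) / 2) (by rw [e]; linarith)
    rw [e] at this
    rw [norm_sub_rev]
    have e' : Complex.exp (-(v : ℂ) / 2) - (1 - (v : ℂ) / 2)
        = Complex.exp (-(v : ℂ) / 2) - 1 - -(v : ℂ) / 2 := by ring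
    rw [e']
    refine this.trans ?_
    have : (v / 2) ^ 2 ≤ (ε ^ 2) ^ 2 := pow_le_pow_left₀ (by positivity) (by linarith) 2
    refine this.trans ?_
    nlinarith [pow_nonneg hε0 3]
  have := norm_add_le _ _ |>.trans (add_le_add b1 b2)
  rw [sub_add_sub_cancel] at this
  linarith

/-- The Gaussian approximation of the characteristic function of a sum of small centered functions
of the coordinates of an i.i.d. family. -/
theorem norm_integral_exp_sum_sub_exp_le {ι : Type*} [Fintype ι] {h : ι → E → ℝ}
    (hm : ∀ i, Measurable (h i)) {ε : ℝ} (hε : ε ≤ 1) (hb : ∀ i x, |h i x| ≤ ε)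
    (h0 : ∀ i, ∫ x, h i x ∂ν = 0) :
    ‖∫ z, Complex.exp (Complex.I * ((∑ i, h i (z i) : ℝ) : ℂ)) ∂(Measure.pi fun _ : ι => ν)
      - Complex.exp (-((∑ i, ∫ x, h i x ^ 2 ∂ν : ℝ) : ℂ) / 2)‖
      ≤ Fintype.card ι * (2 * ε ^ 3) := by
  have e1 : ∫ z, Complex.exp (Complex.I * ((∑ i, h i (z i) : ℝ) : ℂ)) ∂(Measure.pi fun _ : ι => ν)
      = ∏ i, ∫ x, Complex.exp (Complex.I * h i x) ∂ν := by
    rw [← integral_fintype_prod_eq_prod]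
    congr 1; ext z
    rw [← Complex.exp_sum]; push_cast; rw [Finset.mul_sum]
  have e2 : Complex.exp (-((∑ i, ∫ x, h i x ^ 2 ∂ν : ℝ) : ℂ) / 2)
      = ∏ i, Complex.exp (-((∫ x, h i x ^ 2 ∂ν : ℝ) : ℂ) / 2) := by
    rw [← Complex.exp_sum]; push_cast
    rw [← Finset.sum_neg_distrib, Finset.sum_div]
  rw [e1, e2]
  refine (norm_prod_sub_prod_le _ _ _ (fun i => ?_) fun i => ?_).trans ?_
  · have := norm_integral_le_of_norm_le_const (μ := ν) (C := 1)
      (f := fun x => Complex.exp (Complex.I * h i x)) (.of_forall fun x => norm_exp_I_mul_le _)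
    simpa using this
  · rw [Complex.norm_exp]
    have : 0 ≤ ∫ x, h i x ^ 2 ∂ν := integral_nonneg fun x => sq_nonneg _
    rw [Real.exp_le_one_iff]
    have e : (-((∫ x, h i x ^ 2 ∂ν : ℝ) : ℂ) / 2) = ((-(∫ x, h i x ^ 2 ∂ν) / 2 : ℝ) : ℂ) := by
      push_cast; rfl
    rw [e, Complex.ofReal_re]; linarith
  · refine (Finset.sum_le_sum fun i _ =>
      norm_integral_exp_sub_exp_le ν (hm i) hε (hb i) (h0 i)).trans ?_
    simp

end CharacteristicFunction

/-! ### Centered losses of one inducer and their deviation from the pointwise loss -/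

section SingleInducer

variable {𝒵 H : Type*} [MeasurableSpace 𝒵] (ν : Measure 𝒵) [IsProbabilityMeasure ν]
  {ℓ : 𝒵 → H → ℝ} {g : Inducer 𝒵 H} {B : ℝ}

theorem measurable_loss_fixed (hmeas : ∀ n, Measurable fun p : 𝒵 × (Fin n → 𝒵) => ℓ p.1 (g n p.2))
    {n : ℕ} (T : Fin n → 𝒵) : Measurable fun z => ℓ z (g n T) :=
  (hmeas n).comp (measurable_id.prodMk measurable_const)

theorem measurable_risk (hmeas : ∀ n, Measurable fun p : 𝒵 × (Fin n → 𝒵) => ℓ p.1 (g n p.2))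
    (n : ℕ) : Measurable fun T : Fin n → 𝒵 => risk ν ℓ (g n T) :=
  ((hmeas n).stronglyMeasurable.integral_prod_left' (μ := ν)).measurable

theorem abs_risk_le (hB : ∀ z h, |ℓ z h| ≤ B) (h : H) : |risk ν ℓ h| ≤ B :=
  abs_integral_le_of_bounded fun z => hB z h

theorem abs_expectedRisk_le (hB : ∀ z h, |ℓ z h| ≤ B) (n : ℕ) : |expectedRisk ν ℓ g n| ≤ B :=
  abs_integral_le_of_bounded fun _ => abs_risk_le ν hB _

theorem measurable_centeredLoss
    (hmeas : ∀ n, Measurable fun p : 𝒵 × (Fin n → 𝒵) => ℓ p.1 (g n p.2)) (n : ℕ) :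
    Measurable fun p : 𝒵 × (Fin n → 𝒵) => centeredLoss ν ℓ g p.1 p.2 :=
  (hmeas n).sub ((measurable_risk ν hmeas n).comp measurable_snd)

theorem abs_centeredLoss_le (hB : ∀ z h, |ℓ z h| ≤ B) {n : ℕ} (z : 𝒵) (T : Fin n → 𝒵) :
    |centeredLoss ν ℓ g z T| ≤ 2 * B := by
  have := abs_sub (ℓ z (g n T)) (risk ν ℓ (g n T))
  unfold centeredLoss
  linarith [hB z (g n T), abs_risk_le ν hB (g n T)]

theorem integral_centeredLoss (hB : ∀ z h, |ℓ z h| ≤ B)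
    (hmeas : ∀ n, Measurable fun p : 𝒵 × (Fin n → 𝒵) => ℓ p.1 (g n p.2)) {n : ℕ}
    (T : Fin n → 𝒵) : ∫ z, centeredLoss ν ℓ g z T ∂ν = 0 := by
  unfold centeredLoss
  rw [integral_sub (integrable_of_bounded (measurable_loss_fixed hmeas T) fun z => hB z _)
    (integrable_const _)]
  simp [risk]

/-- This makes `lossDeviation` at a fixed `z` a function of the training sample minus its mean, the
form that Efron-Stein requires. -/
theorem pointwiseLoss_eq_integral (hB : ∀ z h, |ℓ z h| ≤ B)
    (hmeas : ∀ n, Measurable fun p : 𝒵 × (Fin n → 𝒵) => ℓ p.1 (g n p.2)) (n : ℕ) (z : 𝒵) :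
    pointwiseLoss ν ℓ g n z = ∫ T, centeredLoss ν ℓ g z T ∂(sampleLaw ν n) := by
  unfold centeredLoss
  rw [integral_sub]
  · rfl
  · exact integrable_of_bounded ((hmeas n).comp (measurable_const.prodMk measurable_id))
      fun T => hB z _
  · exact integrable_of_bounded (measurable_risk ν hmeas n) fun T => abs_risk_le ν hB _

theorem measurable_pointwiseLoss (hB : ∀ z h, |ℓ z h| ≤ B)
    (hmeas : ∀ n, Measurable fun p : 𝒵 × (Fin n → 𝒵) => ℓ p.1 (g n p.2)) (n : ℕ) :
    Measurable (pointwiseLoss ν ℓ g n) := by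
  rw [funext (pointwiseLoss_eq_integral ν hB hmeas n)]
  exact ((measurable_centeredLoss ν hmeas n).stronglyMeasurable.integral_prod_right'
    (ν := sampleLaw ν n)).measurable

theorem abs_pointwiseLoss_le (hB : ∀ z h, |ℓ z h| ≤ B) (n : ℕ) (z : 𝒵) :
    |pointwiseLoss ν ℓ g n z| ≤ 2 * B := by
  have h1 : |∫ T, ℓ z (g n T) ∂(sampleLaw ν n)| ≤ B := abs_integral_le_of_bounded fun T => hB _ _
  have h2 := abs_expectedRisk_le ν (g := g) hB n
  have := abs_sub (∫ T, ℓ z (g n T) ∂(sampleLaw ν n)) (expectedRisk ν ℓ g n)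
  unfold pointwiseLoss
  linarith

theorem integral_pointwiseLoss (hB : ∀ z h, |ℓ z h| ≤ B)
    (hmeas : ∀ n, Measurable fun p : 𝒵 × (Fin n → 𝒵) => ℓ p.1 (g n p.2)) (n : ℕ) :
    ∫ z, pointwiseLoss ν ℓ g n z ∂ν = 0 := by
  simp_rw [pointwiseLoss_eq_integral ν hB hmeas n]
  rw [integral_integral_swap]
  · simp [integral_centeredLoss ν hB hmeas]
  · exact integrable_of_bounded (measurable_centeredLoss ν hmeas n)
      fun p => abs_centeredLoss_le ν hB _ _

/-- The deviation of the centered loss from its mean over the training sample. -/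
noncomputable def lossDeviation (ν : Measure 𝒵) (ℓ : 𝒵 → H → ℝ) (g : Inducer 𝒵 H) {n : ℕ} (z : 𝒵)
    (T : Fin n → 𝒵) : ℝ :=
  centeredLoss ν ℓ g z T - pointwiseLoss ν ℓ g n z

theorem measurable_lossDeviation (hB : ∀ z h, |ℓ z h| ≤ B)
    (hmeas : ∀ n, Measurable fun p : 𝒵 × (Fin n → 𝒵) => ℓ p.1 (g n p.2)) (n : ℕ) :
    Measurable fun p : 𝒵 × (Fin n → 𝒵) => lossDeviation ν ℓ g p.1 p.2 :=
  (measurable_centeredLoss ν hmeas n).sub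
    ((measurable_pointwiseLoss ν hB hmeas n).comp measurable_fst)

theorem abs_lossDeviation_le (hB : ∀ z h, |ℓ z h| ≤ B) {n : ℕ} (z : 𝒵) (T : Fin n → 𝒵) :
    |lossDeviation ν ℓ g z T| ≤ 4 * B := by
  have := abs_sub (centeredLoss ν ℓ g z T) (pointwiseLoss ν ℓ g n z)
  unfold lossDeviation
  linarith [abs_centeredLoss_le ν (g := g) hB z T, abs_pointwiseLoss_le ν (g := g) hB n z]

/-- Centering in the validation point for each fixed training sample is the source of the
orthogonality within a fold. -/
theorem integral_lossDeviation (hB : ∀ z h, |ℓ z h| ≤ B)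
    (hmeas : ∀ n, Measurable fun p : 𝒵 × (Fin n → 𝒵) => ℓ p.1 (g n p.2)) {n : ℕ}
    (T : Fin n → 𝒵) : ∫ z, lossDeviation ν ℓ g z T ∂ν = 0 := by
  unfold lossDeviation
  rw [integral_sub, integral_centeredLoss ν hB hmeas, integral_pointwiseLoss ν hB hmeas, sub_zero]
  · exact integrable_of_bounded ((measurable_centeredLoss ν hmeas n).comp
      (measurable_id.prodMk measurable_const)) fun z => abs_centeredLoss_le ν hB _ _
  · exact integrable_of_bounded (measurable_pointwiseLoss ν hB hmeas n)
      fun z => abs_pointwiseLoss_le ν hB _ _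

omit [IsProbabilityMeasure ν] in
theorem centeredLoss_comp_perm (hperm : g.PermInvariant) {n : ℕ} (z : 𝒵) (T : Fin n → 𝒵)
    (σ : Equiv.Perm (Fin n)) : centeredLoss ν ℓ g z (fun i => T (σ i)) = centeredLoss ν ℓ g z T := by
  have := hperm n T σ
  unfold centeredLoss
  rw [show (fun i => T (σ i)) = T ∘ σ from rfl, this]

/-- For an inducer that ignores the ordering, resampling any training point has the effect of
resampling the last one. -/
theorem integral_sq_sub_update_eq_lossInstability
    (hmeas : ∀ n, Measurable fun p : 𝒵 × (Fin n → 𝒵) => ℓ p.1 (g n p.2))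
    (hperm : g.PermInvariant) {n : ℕ} (k : Fin n) :
    ∫ q : 𝒵 × (Fin n → 𝒵) × 𝒵,
      (centeredLoss ν ℓ g q.1 q.2.1
        - centeredLoss ν ℓ g q.1 (Function.update q.2.1 k q.2.2)) ^ 2
      ∂(ν.prod ((sampleLaw ν n).prod ν)) = lossInstability ν ℓ g n := by
  obtain ⟨m, rfl⟩ : ∃ m, n = m + 1 := ⟨n - 1, by have := k.2; omega⟩
  set P := sampleLaw ν (m + 1) with hP
  -- Relabelling by `σ` preserves the sample law and, by permutation invariance, the loss; it
  -- carries the resampled position `k` to the last one.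
  set σ : Equiv.Perm (Fin (m + 1)) := Equiv.swap k (Fin.last m) with hσ
  have hφ : MeasurePreserving
      (fun q : 𝒵 × (Fin (m + 1) → 𝒵) × 𝒵 => ((fun i => q.2.1 (σ i)), q.2.2, q.1))
      (ν.prod (P.prod ν)) (P.prod (ν.prod ν)) :=
    ((measurePreserving_comp_injective ν σ.injective).prod (MeasurePreserving.id _)).comp
      ((measurePreserving_prodAssoc P ν ν).comp Measure.measurePreserving_swap)
  have hrep : ∀ (T : Fin (m + 1) → 𝒵) x, replaceLast T x = Function.update T (Fin.last m) x := by
    intro T x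
    ext1 i
    by_cases h : i = Fin.last m
    · subst h; simp [replaceLast]
    · have : (i : ℕ) ≠ m := fun h' => h (Fin.ext h')
      simp [replaceLast, h, this]
  unfold lossInstability
  have hupd : Measurable fun p : (Fin (m + 1) → 𝒵) × 𝒵 × 𝒵 => replaceLast p.1 p.2.1 := by
    simp_rw [hrep]
    exact (measurePreserving_update ν (Fin.last m)).measurable.comp
      (measurable_fst.prodMk (measurable_fst.comp measurable_snd))
  have hc := measurable_centeredLoss ν hmeas (m + 1)
  rw [← integral_comp_eq hφ]
  · congr 1; ext q
    dsimp only
    rw [centeredLoss_comp_perm ν hperm, ← centeredLoss_comp_perm ν hperm q.1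
      (Function.update q.2.1 k q.2.2) σ, hrep]
    congr 3
    ext1 i
    by_cases h : i = Fin.last m
    · subst h; simp [hσ]
    · have : σ i ≠ k := by
        intro h'
        apply h
        have := congrArg σ h'
        simpa [hσ] using this
      simp [h, this]
  · exact ((hc.comp ((measurable_snd.comp measurable_snd).prodMk measurable_fst)).sub
      (hc.comp ((measurable_snd.comp measurable_snd).prodMk hupd))).pow_const 2

/-- Efron-Stein in the training sample for each fixed `z`, integrated over `z`; by permutation
invariance the `n` coordinates contribute equally. Under loss stability the bound is `o(1)`. -/
theorem integral_lossDeviation_sq_le (hB : ∀ z h, |ℓ z h| ≤ B)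
    (hmeas : ∀ n, Measurable fun p : 𝒵 × (Fin n → 𝒵) => ℓ p.1 (g n p.2))
    (hperm : g.PermInvariant) (n : ℕ) :
    ∫ p, lossDeviation ν ℓ g p.1 p.2 ^ 2 ∂(ν.prod (sampleLaw ν n))
      ≤ n / 2 * lossInstability ν ℓ g n := by
  set P := sampleLaw ν n with hP
  have hc := measurable_centeredLoss ν hmeas n
  have hi1 : Integrable (fun p : 𝒵 × (Fin n → 𝒵) => lossDeviation ν ℓ g p.1 p.2 ^ 2)
      (ν.prod P) :=
    integrable_of_bounded ((measurable_lossDeviation ν hB hmeas n).pow_const 2)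
      (C := (4 * B) ^ 2) fun p => by
        rw [abs_pow]; exact pow_le_pow_left₀ (abs_nonneg _) (abs_lossDeviation_le ν hB _ _) 2
  have hi2 (k : Fin n) : Integrable (fun q : 𝒵 × (Fin n → 𝒵) × 𝒵 =>
      (centeredLoss ν ℓ g q.1 q.2.1
        - centeredLoss ν ℓ g q.1 (Function.update q.2.1 k q.2.2)) ^ 2) (ν.prod (P.prod ν)) := by
    refine integrable_of_bounded (C := (4 * B) ^ 2) (((hc.comp
      (measurable_fst.prodMk (measurable_fst.comp measurable_snd))).sub (hc.comp
      (measurable_fst.prodMk ((measurePreserving_update ν k).measurable.comp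
        measurable_snd)))).pow_const 2) fun q => ?_
    rw [abs_pow]
    refine pow_le_pow_left₀ (abs_nonneg _) ?_ 2
    have := abs_sub (centeredLoss ν ℓ g q.1 q.2.1)
      (centeredLoss ν ℓ g q.1 (Function.update q.2.1 k q.2.2))
    linarith [abs_centeredLoss_le ν (g := g) hB q.1 q.2.1,
      abs_centeredLoss_le ν (g := g) hB q.1 (Function.update q.2.1 k q.2.2)]
  rw [integral_prod _ hi1]
  have hle : ∫ z, ∫ T, lossDeviation ν ℓ g z T ^ 2 ∂P ∂ν
      ≤ ∫ z, (1 / 2) * ∑ k, ∫ p : (Fin n → 𝒵) × 𝒵, (centeredLoss ν ℓ g z p.1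
        - centeredLoss ν ℓ g z (Function.update p.1 k p.2)) ^ 2 ∂(P.prod ν) ∂ν := by
    refine integral_mono hi1.integral_prod_left
      ((integrable_finsetSum _ fun k _ => (hi2 k).integral_prod_left).const_mul _) fun z => ?_
    have := integral_sub_integral_sq_le_sum ν
      (f := fun T => centeredLoss ν ℓ g z T) (hc.comp (measurable_const.prodMk measurable_id))
      (fun T => abs_centeredLoss_le ν hB z T)
    simpa only [lossDeviation, pointwiseLoss_eq_integral ν hB hmeas n z] using this
  refine hle.trans_eq ?_
  rw [integral_const_mul, integral_finsetSum _ fun k _ => (hi2 k).integral_prod_left]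
  simp_rw [← integral_prod _ (hi2 _), hP, integral_sq_sub_update_eq_lossInstability ν hmeas hperm]
  simp; ring

end SingleInducer

/-! ### Linearization of the validation loss -/

section Fold

variable {𝒵 H : Type*}

/-- The observations with index outside of `V`. -/
def trainSample {n : ℕ} (V : Finset (Fin n)) (z : Fin n → 𝒵) : Fin Vᶜ.card → 𝒵 :=
  fun k => z (Vᶜ.orderEmbOfFin rfl k)

/-- A validation point can be replaced by a fresh copy without touching the training sample; this
encodes their independence. -/
theorem trainSample_update {n : ℕ} {V : Finset (Fin n)} {i : Fin n} (hi : i ∈ V) (z : Fin n → 𝒵)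
    (x : 𝒵) : trainSample V (Function.update z i x) = trainSample V z := by
  ext1 k
  have h : Vᶜ.orderEmbOfFin rfl k ∈ Vᶜ := Finset.orderEmbOfFin_mem _ _ _
  have : Vᶜ.orderEmbOfFin rfl k ≠ i := fun h' => Finset.mem_compl.1 (h' ▸ h) hi
  simp [trainSample, this]

theorem integral_abs_le_sqrt {Ω : Type*} [MeasurableSpace Ω] {μ : Measure Ω}
    [IsProbabilityMeasure μ] {f : Ω → ℝ} (hf : Integrable f μ)
    (hf2 : Integrable (fun x => f x ^ 2) μ) : ∫ x, |f x| ∂μ ≤ √(∫ x, f x ^ 2 ∂μ) := by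
  apply Real.le_sqrt_of_sq_le
  set m := ∫ x, |f x| ∂μ with hm
  have h0 : 0 ≤ ∫ x, (f x ^ 2 - 2 * m * |f x| + m ^ 2) ∂μ := by
    refine integral_nonneg fun x => ?_
    have : f x ^ 2 - 2 * m * |f x| + m ^ 2 = (|f x| - m) ^ 2 := by rw [sub_sq, sq_abs]; ring
    simp only [this]; positivity
  have hi := hf.abs.const_mul (2 * m)
  rw [integral_add (by exact hf2.sub hi) (integrable_const _), integral_sub hf2 hi,
    integral_const_mul, ← hm] at h0
  simp at h0
  nlinarith

variable [MeasurableSpace 𝒵] (ν : Measure 𝒵) [IsProbabilityMeasure ν]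
  {ℓ : 𝒵 → H → ℝ} {g : Inducer 𝒵 H} {B : ℝ}

theorem measurePreserving_trainSample {n : ℕ} (V : Finset (Fin n)) :
    MeasurePreserving (trainSample V) (sampleLaw ν n) (sampleLaw ν Vᶜ.card) :=
  measurePreserving_comp_injective ν (Vᶜ.orderEmbOfFin rfl).injective

theorem measurable_validation_lossDeviation (hB : ∀ z h, |ℓ z h| ≤ B)
    (hmeas : ∀ n, Measurable fun p : 𝒵 × (Fin n → 𝒵) => ℓ p.1 (g n p.2)) {n : ℕ}
    (V : Finset (Fin n)) (i : Fin n) :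
    Measurable fun z : Fin n → 𝒵 => lossDeviation ν ℓ g (z i) (trainSample V z) :=
  (measurable_lossDeviation ν hB hmeas _).comp
    ((measurable_pi_apply i).prodMk (measurePreserving_trainSample ν V).measurable)

/-- Resample observation `i`. For `k ≠ i` the second factor is unaffected, and integrating the first
over the fresh copy gives `0`; for `k = i` the fresh copy and the training sample have the product
law. -/
theorem integral_lossDeviation_mul_eq (hB : ∀ z h, |ℓ z h| ≤ B)
    (hmeas : ∀ n, Measurable fun p : 𝒵 × (Fin n → 𝒵) => ℓ p.1 (g n p.2)) {n : ℕ}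
    {V : Finset (Fin n)} {i k : Fin n} (hi : i ∈ V) :
    ∫ z, lossDeviation ν ℓ g (z i) (trainSample V z) * lossDeviation ν ℓ g (z k) (trainSample V z)
      ∂(sampleLaw ν n) = if k = i then
        ∫ p, lossDeviation ν ℓ g p.1 p.2 ^ 2 ∂(ν.prod (sampleLaw ν Vᶜ.card)) else 0 := by
  have hD := measurable_lossDeviation ν hB hmeas Vᶜ.card
  have hV := (measurePreserving_trainSample ν V).measurable
  have hDi (j : Fin n) := measurable_validation_lossDeviation ν hB hmeas V j
  rw [← integral_comp_eq (measurePreserving_update ν i) ((hDi i).fun_mul (hDi k))]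
  simp only [trainSample_update hi, Function.update_self]
  split_ifs with h
  · subst h
    have hφ : MeasurePreserving (fun p : (Fin n → 𝒵) × 𝒵 => (p.2, trainSample V p.1))
        ((sampleLaw ν n).prod ν) (ν.prod (sampleLaw ν Vᶜ.card)) :=
      Measure.measurePreserving_swap.comp
        ((measurePreserving_trainSample ν V).prod (MeasurePreserving.id ν))
    rw [← integral_comp_eq hφ (hD.pow_const 2)]
    simp [pow_two]
  · simp only [Function.update_of_ne h]
    rw [integral_prod]
    · simp only [integral_mul_const, integral_lossDeviation ν hB hmeas, zero_mul, integral_zero]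
    · refine integrable_of_bounded ((hD.comp (measurable_snd.prodMk (hV.comp measurable_fst))).mul
        ((hDi k).comp measurable_fst)) (C := (4 * B) * (4 * B)) fun p => ?_
      rw [abs_mul]
      exact mul_le_mul (abs_lossDeviation_le ν hB _ _) (abs_lossDeviation_le ν hB _ _)
        (abs_nonneg _) ((abs_nonneg _).trans (abs_lossDeviation_le ν (g := g) hB (p.1 i) p.1))

theorem integral_sum_lossDeviation_sq_eq (hB : ∀ z h, |ℓ z h| ≤ B)
    (hmeas : ∀ n, Measurable fun p : 𝒵 × (Fin n → 𝒵) => ℓ p.1 (g n p.2)) {n : ℕ}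
    (V : Finset (Fin n)) :
    ∫ z, (∑ i ∈ V, lossDeviation ν ℓ g (z i) (trainSample V z)) ^ 2 ∂(sampleLaw ν n)
      = V.card * ∫ p, lossDeviation ν ℓ g p.1 p.2 ^ 2 ∂(ν.prod (sampleLaw ν Vᶜ.card)) := by
  have hint (i k : Fin n) : Integrable (fun z => lossDeviation ν ℓ g (z i) (trainSample V z)
      * lossDeviation ν ℓ g (z k) (trainSample V z)) (sampleLaw ν n) := by
    refine integrable_of_bounded ((measurable_validation_lossDeviation ν hB hmeas V i).mul
      (measurable_validation_lossDeviation ν hB hmeas V k)) (C := (4 * B) * (4 * B)) fun z => ?_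
    rw [abs_mul]
    exact mul_le_mul (abs_lossDeviation_le ν hB _ _) (abs_lossDeviation_le ν hB _ _)
      (abs_nonneg _) ((abs_nonneg _).trans (abs_lossDeviation_le ν (g := g) hB (z i) z))
  simp_rw [pow_two (∑ i ∈ V, _), Finset.sum_mul_sum]
  rw [integral_finsetSum _ fun i _ => integrable_finsetSum _ fun k _ => hint i k]
  have (i) (hi : i ∈ V) : ∫ z, ∑ k ∈ V, lossDeviation ν ℓ g (z i) (trainSample V z)
      * lossDeviation ν ℓ g (z k) (trainSample V z) ∂(sampleLaw ν n)
      = ∫ p, lossDeviation ν ℓ g p.1 p.2 ^ 2 ∂(ν.prod (sampleLaw ν Vᶜ.card)) := by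
    rw [integral_finsetSum _ fun k _ => hint i k]
    simp_rw [integral_lossDeviation_mul_eq ν hB hmeas hi]
    simp [hi]
  rw [Finset.sum_congr rfl this]
  simp

/-- A bound for the mean error of the linearization of the loss on one fold of size `v`, when the
total sample size is `n`; the risk of the fitted model is compared to `r`. -/
noncomputable def linearizationError (ν : Measure 𝒵) (ℓ : 𝒵 → H → ℝ) (g : Inducer 𝒵 H) (r : ℝ)
    (n v : ℕ) : ℝ :=
  √(((n - v : ℕ) : ℝ) / 2 * lossInstability ν ℓ g (n - v) / v)
    + ∫ T, |risk ν ℓ (g (n - v) T) - r| ∂(sampleLaw ν (n - v))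
    + ∫ T, |risk ν ℓ (g n T) - r| ∂(sampleLaw ν n)

theorem measurable_foldLoss
    (hmeas : ∀ n, Measurable fun p : 𝒵 × (Fin n → 𝒵) => ℓ p.1 (g n p.2)) {n : ℕ}
    (V : Finset (Fin n)) : Measurable fun z : Fin n → 𝒵 => foldLoss ℓ g z V := by
  unfold foldLoss
  refine Measurable.const_mul (Finset.measurable_fun_sum _ fun i _ => ?_) _
  exact (hmeas _).comp ((measurable_pi_apply i).prodMk
    (measurable_pi_lambda (trainSample V) fun k => measurable_pi_apply _))

/-- The error is `D / v` plus the risk fluctuation, where `D` sums the deviations over the fold.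
Orthogonality gives `E[D²] = v · E[lossDeviation²]`, so only a factor `1/v` remains after squaring
`D / v`. The reference value `r` links the risks at the two sample sizes. -/
theorem integral_abs_foldLoss_sub_le (hB : ∀ z h, |ℓ z h| ≤ B)
    (hmeas : ∀ n, Measurable fun p : 𝒵 × (Fin n → 𝒵) => ℓ p.1 (g n p.2))
    (hperm : g.PermInvariant) (r : ℝ) {n v : ℕ} (hv : 0 < v) {V : Finset (Fin n)}
    (hV : V.card = v) :
    ∫ z, |foldLoss ℓ g z V - expectedRisk ν ℓ g n
        - 1 / (v : ℝ) * ∑ i ∈ V, pointwiseLoss ν ℓ g (n - v) (z i)| ∂(sampleLaw ν n)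
      ≤ linearizationError ν ℓ g r n v := by
  have hN : Vᶜ.card = n - v := by rw [Finset.card_compl, hV, Fintype.card_fin]
  have hv' : (v : ℝ) ≠ 0 := by exact_mod_cast hv.ne'
  unfold linearizationError
  -- The training sample has type `Fin Vᶜ.card → 𝒵`, so `n - v` is rewritten to `Vᶜ.card` rather
  -- than the other way round.
  rw [← hN]
  set D : (Fin n → 𝒵) → ℝ := fun z => ∑ i ∈ V, lossDeviation ν ℓ g (z i) (trainSample V z) with hDdef
  have hDm : Measurable D := Finset.measurable_fun_sum _ fun i _ =>
    measurable_validation_lossDeviation ν hB hmeas V i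
  have hDb (z) : |D z| ≤ V.card * (4 * B) := by
    refine (Finset.abs_sum_le_sum_abs _ _).trans ?_
    refine (Finset.sum_le_sum fun i _ => abs_lossDeviation_le ν hB _ _).trans ?_
    simp
  have hDi : Integrable D (sampleLaw ν n) := integrable_of_bounded hDm hDb
  have hDi2 : Integrable (fun z => D z ^ 2) (sampleLaw ν n) :=
    integrable_of_bounded (hDm.pow_const 2) (C := (V.card * (4 * B)) ^ 2) fun z => by
      rw [abs_pow]; exact pow_le_pow_left₀ (abs_nonneg _) (hDb z) 2
  have hRm : Measurable fun z : Fin n → 𝒵 => risk ν ℓ (g _ (trainSample V z)) - r :=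
    ((measurable_risk ν hmeas _).comp (measurePreserving_trainSample ν V).measurable).sub_const r
  have hRb (m : ℕ) (T : Fin m → 𝒵) : |risk ν ℓ (g m T) - r| ≤ B + |r| :=
    (abs_sub _ _).trans (by linarith [abs_risk_le ν hB (g m T)])
  have hRi : Integrable (fun z : Fin n → 𝒵 => risk ν ℓ (g _ (trainSample V z)) - r)
      (sampleLaw ν n) := integrable_of_bounded hRm fun z => hRb _ _
  have hμ : |expectedRisk ν ℓ g n - r| ≤ ∫ T, |risk ν ℓ (g n T) - r| ∂(sampleLaw ν n) := by
    have : expectedRisk ν ℓ g n - r = ∫ T, (risk ν ℓ (g n T) - r) ∂(sampleLaw ν n) := by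
      rw [integral_sub (integrable_of_bounded (measurable_risk ν hmeas n)
        fun T => abs_risk_le ν hB _) (integrable_const _)]
      simp [expectedRisk]
    rw [this]
    exact abs_integral_le_integral_abs
  have hdec (z : Fin n → 𝒵) : foldLoss ℓ g z V - expectedRisk ν ℓ g n
      - 1 / (v : ℝ) * ∑ i ∈ V, pointwiseLoss ν ℓ g Vᶜ.card (z i)
      = 1 / (v : ℝ) * D z + (risk ν ℓ (g _ (trainSample V z)) - r)
        - (expectedRisk ν ℓ g n - r) := by
    simp only [foldLoss, hV, hDdef, lossDeviation, centeredLoss, Finset.sum_sub_distrib,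
      Finset.sum_const, nsmul_eq_mul]
    have : fitOutside g z V = g _ (trainSample V z) := rfl
    rw [this]
    field_simp
    ring
  have hle : ∫ z, |foldLoss ℓ g z V - expectedRisk ν ℓ g n
        - 1 / (v : ℝ) * ∑ i ∈ V, pointwiseLoss ν ℓ g Vᶜ.card (z i)| ∂(sampleLaw ν n)
      ≤ ∫ z, (1 / (v : ℝ) * |D z| + |risk ν ℓ (g _ (trainSample V z)) - r|
        + |expectedRisk ν ℓ g n - r|) ∂(sampleLaw ν n) := by
    refine integral_mono ?_ (((hDi.abs.const_mul _).add hRi.abs).add (integrable_const _))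
      fun z => ?_
    · simp_rw [hdec]
      exact (((hDi.const_mul _).add hRi).sub (integrable_const _)).abs
    · dsimp only
      rw [hdec z]
      refine (abs_sub _ _).trans (add_le_add ((abs_add_le _ _).trans (add_le_add ?_ le_rfl)) le_rfl)
      rw [abs_mul, abs_of_nonneg (by positivity)]
  refine hle.trans ?_
  rw [integral_add (by exact (hDi.abs.const_mul _).add hRi.abs) (integrable_const _),
    integral_add (hDi.abs.const_mul _) hRi.abs, integral_const_mul]
  have h2 : ∫ z, |risk ν ℓ (g _ (trainSample V z)) - r| ∂(sampleLaw ν n)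
      = ∫ T, |risk ν ℓ (g Vᶜ.card T) - r| ∂(sampleLaw ν Vᶜ.card) :=
    integral_comp_eq (measurePreserving_trainSample ν V) (f := fun T => |risk ν ℓ (g _ T) - r|)
      (((measurable_risk ν hmeas _).sub_const r).abs)
  have h1 : 1 / (v : ℝ) * ∫ z, |D z| ∂(sampleLaw ν n)
      ≤ √((Vᶜ.card : ℝ) / 2 * lossInstability ν ℓ g Vᶜ.card / v) := by
    apply Real.le_sqrt_of_sq_le
    have hs := integral_abs_le_sqrt hDi hDi2
    have hn : 0 ≤ ∫ z, |D z| ∂(sampleLaw ν n) := integral_nonneg fun z => abs_nonneg _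
    have hs2 := (Real.le_sqrt hn (integral_nonneg fun z => sq_nonneg _)).1 hs
    rw [hDdef, integral_sum_lossDeviation_sq_eq ν hB hmeas V, ← hDdef, hV] at hs2
    have hE := integral_lossDeviation_sq_le ν hB hmeas hperm Vᶜ.card
    rw [mul_pow]
    calc (1 / (v : ℝ)) ^ 2 * (∫ z, |D z| ∂(sampleLaw ν n)) ^ 2
        ≤ (1 / (v : ℝ)) ^ 2 * (v * ((Vᶜ.card : ℝ) / 2 * lossInstability ν ℓ g Vᶜ.card)) := by
          refine mul_le_mul_of_nonneg_left (hs2.trans ?_) (by positivity)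
          exact mul_le_mul_of_nonneg_left hE (by positivity)
      _ = _ := by field_simp
  simp only [integral_const, probReal_univ, one_smul]
  rw [h2]
  linarith

theorem measurable_validationLoss
    (hmeas : ∀ n, Measurable fun p : 𝒵 × (Fin n → 𝒵) => ℓ p.1 (g n p.2)) {n M : ℕ}
    (V : Fin M → Finset (Fin n)) : Measurable fun z : Fin n → 𝒵 => validationLoss ℓ g z V :=
  Measurable.const_mul (Finset.measurable_fun_sum _ fun m _ => measurable_foldLoss hmeas (V m)) _

omit [MeasurableSpace 𝒵] in
theorem abs_foldLoss_le (hB : ∀ z h, |ℓ z h| ≤ B) (hB0 : 0 ≤ B) {n : ℕ} (z : Fin n → 𝒵)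
    (V : Finset (Fin n)) : |foldLoss ℓ g z V| ≤ B := by
  unfold foldLoss
  rw [abs_mul, abs_of_nonneg (by positivity : (0 : ℝ) ≤ 1 / V.card)]
  have h : |∑ i ∈ V, ℓ (z i) (fitOutside g z V)| ≤ V.card * B := by
    refine (Finset.abs_sum_le_sum_abs _ _).trans ((Finset.sum_le_sum fun i _ => hB _ _).trans ?_)
    simp
  -- For empty `V` the fold loss is `0` by the convention `1 / 0 = 0`.
  rcases Nat.eq_zero_or_pos V.card with h0 | h0
  · rw [h0]; simpa using hB0
  · have h0' : (0 : ℝ) < V.card := by exact_mod_cast h0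
    calc 1 / (V.card : ℝ) * |∑ i ∈ V, ℓ (z i) (fitOutside g z V)|
        ≤ 1 / (V.card : ℝ) * (V.card * B) := mul_le_mul_of_nonneg_left h (by positivity)
      _ = B := by field_simp

/-- How often the observation `s` is used for validation. -/
def useCount {n M : ℕ} (V : Fin M → Finset (Fin n)) (s : Fin n) : ℕ := ∑ m, if s ∈ V m then 1 else 0

theorem useCount_le {n M : ℕ} (V : Fin M → Finset (Fin n)) (s : Fin n) : useCount V s ≤ M := by
  unfold useCount
  refine (Finset.sum_le_sum fun m _ => (by split_ifs <;> simp : _ ≤ 1)).trans ?_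
  simp

/-- Regrouping by observation turns possibly overlapping, dependent folds into a sum of independent
terms. -/
theorem sum_sum_eq_sum_useCount_mul {n M : ℕ} (V : Fin M → Finset (Fin n)) (b : Fin n → ℝ) :
    ∑ m, ∑ s ∈ V m, b s = ∑ s, (useCount V s : ℝ) * b s := by
  simp only [useCount, Nat.cast_sum, Finset.sum_mul]
  rw [Finset.sum_comm]
  refine Finset.sum_congr rfl fun m _ => ?_
  simp [Finset.sum_ite_mem]

/-- Both sides count triples `(s, m, m')` with `s ∈ V m ∩ W m'`. Through this identity the variance
sees the validation sets only via their overlaps. -/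
theorem sum_useCount_mul_useCount {n M : ℕ} (V W : Fin M → Finset (Fin n)) :
    ∑ s, (useCount V s : ℝ) * useCount W s = overlap V W := by
  simp only [useCount, overlap, Nat.cast_sum, Finset.sum_mul_sum]
  rw [Finset.sum_comm]
  refine Finset.sum_congr rfl fun m _ => ?_
  rw [Finset.sum_comm]
  refine Finset.sum_congr rfl fun m' _ => ?_
  have : ∀ s, (((if s ∈ V m then 1 else 0 : ℕ) : ℝ) * ((if s ∈ W m' then 1 else 0 : ℕ) : ℝ))
      = if s ∈ V m ∩ W m' then 1 else 0 := by
    intro s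
    by_cases h1 : s ∈ V m <;> by_cases h2 : s ∈ W m' <;> simp [h1, h2]
  simp only [this]
  simp
  congr 1
  ext s
  simp

/-- The validation loss is close to an average of the centered pointwise losses, in mean. -/
theorem integral_abs_validationLoss_sub_le (hB : ∀ z h, |ℓ z h| ≤ B)
    (hmeas : ∀ n, Measurable fun p : 𝒵 × (Fin n → 𝒵) => ℓ p.1 (g n p.2))
    (hperm : g.PermInvariant) (r : ℝ) {n M v : ℕ} (hM : 0 < M) (hv : 0 < v)
    {V : Fin M → Finset (Fin n)} (hV : ∀ m, (V m).card = v) :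
    ∫ z, |validationLoss ℓ g z V - expectedRisk ν ℓ g n
        - ∑ s, useCount V s / (M * v : ℝ) * pointwiseLoss ν ℓ g (n - v) (z s)| ∂(sampleLaw ν n)
      ≤ linearizationError ν ℓ g r n v := by
  have hM' : (M : ℝ) ≠ 0 := by exact_mod_cast hM.ne'
  have hv' : (v : ℝ) ≠ 0 := by exact_mod_cast hv.ne'
  set F : Fin M → (Fin n → 𝒵) → ℝ := fun m z => foldLoss ℓ g z (V m) - expectedRisk ν ℓ g n
        - 1 / (v : ℝ) * ∑ i ∈ V m, pointwiseLoss ν ℓ g (n - v) (z i) with hF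
  have hdec (z : Fin n → 𝒵) : validationLoss ℓ g z V - expectedRisk ν ℓ g n
        - ∑ s, useCount V s / (M * v : ℝ) * pointwiseLoss ν ℓ g (n - v) (z s)
      = 1 / (M : ℝ) * ∑ m, F m z := by
    simp only [hF, validationLoss, Finset.sum_sub_distrib, ← Finset.mul_sum,
      sum_sum_eq_sum_useCount_mul V (fun s => pointwiseLoss ν ℓ g (n - v) (z s)), Finset.sum_const,
      Finset.card_univ, Fintype.card_fin, nsmul_eq_mul]
    have : ∑ s, (useCount V s : ℝ) / (M * v : ℝ) * pointwiseLoss ν ℓ g (n - v) (z s)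
        = 1 / (M * v : ℝ) * ∑ s, (useCount V s : ℝ) * pointwiseLoss ν ℓ g (n - v) (z s) := by
      rw [Finset.mul_sum]; exact Finset.sum_congr rfl fun s _ => by ring
    rw [this]
    field_simp
  have hFm (m) : Measurable (F m) :=
    ((measurable_foldLoss hmeas (V m)).sub_const _).sub (Measurable.const_mul
      (Finset.measurable_fun_sum _ fun i _ =>
        (measurable_pointwiseLoss ν hB hmeas _).comp (measurable_pi_apply i)) _)
  obtain ⟨x0⟩ : Nonempty 𝒵 := by
    by_contra hne
    rw [not_nonempty_iff] at hne
    exact (IsProbabilityMeasure.ne_zero ν) (Measure.eq_zero_of_isEmpty ν)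
  have hB0 : 0 ≤ B := (abs_nonneg _).trans (hB x0 (g 0 Fin.elim0))
  have hFi (m) : Integrable (F m) (sampleLaw ν n) := by
    refine integrable_of_bounded (hFm m) (C := B + B + 1 / (v : ℝ) * (n * (2 * B))) fun z => ?_
    refine (abs_sub _ _).trans (add_le_add ((abs_sub _ _).trans (add_le_add
      (abs_foldLoss_le hB hB0 _ _) (abs_expectedRisk_le ν hB n))) ?_)
    rw [abs_mul, abs_of_nonneg (by positivity : (0 : ℝ) ≤ 1 / v)]
    refine mul_le_mul_of_nonneg_left ?_ (by positivity)
    refine (Finset.abs_sum_le_sum_abs _ _).trans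
      ((Finset.sum_le_sum fun i _ => abs_pointwiseLoss_le ν hB _ _).trans ?_)
    simp only [Finset.sum_const, nsmul_eq_mul]
    refine mul_le_mul_of_nonneg_right ?_ (by positivity)
    exact_mod_cast (Finset.card_le_univ (V m)).trans_eq (Fintype.card_fin n)
  simp_rw [hdec]
  have hle : ∫ z, |1 / (M : ℝ) * ∑ m, F m z| ∂(sampleLaw ν n)
      ≤ ∫ z, 1 / (M : ℝ) * ∑ m, |F m z| ∂(sampleLaw ν n) := by
    refine integral_mono ((integrable_finsetSum _ fun m _ => hFi m).const_mul _).abs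
      ((integrable_finsetSum _ fun m _ => (hFi m).abs).const_mul _) fun z => ?_
    dsimp only
    rw [abs_mul, abs_of_nonneg (by positivity : (0 : ℝ) ≤ 1 / M)]
    exact mul_le_mul_of_nonneg_left (Finset.abs_sum_le_sum_abs _ _) (by positivity)
  refine hle.trans ?_
  rw [integral_const_mul, integral_finsetSum _ fun m _ => (hFi m).abs]
  have : ∑ m, ∫ z, |F m z| ∂(sampleLaw ν n) ≤ M * linearizationError ν ℓ g r n v := by
    refine (Finset.sum_le_sum fun m _ =>
      integral_abs_foldLoss_sub_le ν hB hmeas hperm r hv (hV m)).trans ?_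
    simp
  calc 1 / (M : ℝ) * ∑ m, ∫ z, |F m z| ∂(sampleLaw ν n)
      ≤ 1 / (M : ℝ) * (M * linearizationError ν ℓ g r n v) :=
        mul_le_mul_of_nonneg_left this (by positivity)
    _ = _ := by field_simp

end Fold

/-! ### Characteristic function of the scaled error at a fixed sample size -/

section FixedSampleSize

theorem norm_exp_I_mul_sub_le (x y : ℝ) :
    ‖Complex.exp (Complex.I * x) - Complex.exp (Complex.I * y)‖ ≤ |x - y| := by
  have e : Complex.exp (Complex.I * x) - Complex.exp (Complex.I * y)
      = Complex.exp (Complex.I * y) * (Complex.exp (Complex.I * ((x - y : ℝ) : ℂ)) - 1) := by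
    rw [mul_sub, ← Complex.exp_add]; push_cast; ring_nf
  rw [e, norm_mul, Complex.norm_exp_I_mul_ofReal, one_mul]
  exact Real.norm_exp_I_mul_ofReal_sub_one_le

theorem abs_exp_neg_half_sub_le {x y : ℝ} (hx : 0 ≤ x) (hy : 0 ≤ y) :
    |Real.exp (-x / 2) - Real.exp (-y / 2)| ≤ |x - y| / 2 := by
  wlog h : x ≤ y generalizing x y
  · rw [abs_sub_comm, abs_sub_comm x y]; exact this hy hx (le_of_not_ge h)
  have h1 : Real.exp (-y / 2) ≤ Real.exp (-x / 2) := Real.exp_le_exp.2 (by linarith)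
  rw [abs_of_nonneg (by linarith), abs_sub_comm x y, abs_of_nonneg (by linarith : 0 ≤ y - x)]
  have h2 : Real.exp (-y / 2) = Real.exp (-x / 2) * Real.exp (-(y - x) / 2) := by
    rw [← Real.exp_add]; ring_nf
  have h3 := Real.add_one_le_exp (-(y - x) / 2)
  have h4 : Real.exp (-x / 2) ≤ 1 := Real.exp_le_one_iff.2 (by linarith)
  rw [h2]
  nlinarith [Real.exp_pos (-x / 2)]

variable {𝒵 H : Type*} [MeasurableSpace 𝒵] (ν : Measure 𝒵) [IsProbabilityMeasure ν]
  {ℓ : 𝒵 → H → ℝ} {J M n v : ℕ} {g : Fin J → Inducer 𝒵 H} {B : ℝ}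

theorem integrable_validationLoss (hB : ∀ z h, |ℓ z h| ≤ B) {g : Inducer 𝒵 H}
    (hmeas : ∀ n, Measurable fun p : 𝒵 × (Fin n → 𝒵) => ℓ p.1 (g n p.2))
    (V : Fin M → Finset (Fin n)) :
    Integrable (fun z : Fin n → 𝒵 => validationLoss ℓ g z V) (sampleLaw ν n) := by
  obtain ⟨x0⟩ : Nonempty 𝒵 := by
    by_contra hne
    rw [not_nonempty_iff] at hne
    exact (IsProbabilityMeasure.ne_zero ν) (Measure.eq_zero_of_isEmpty ν)
  have hB0 : 0 ≤ B := (abs_nonneg _).trans (hB x0 (g 0 Fin.elim0))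
  refine integrable_of_bounded (measurable_validationLoss hmeas V)
    (C := 1 / (M : ℝ) * (M * B)) fun z => ?_
  rw [validationLoss, abs_mul, abs_of_nonneg (by positivity : (0 : ℝ) ≤ 1 / M)]
  refine mul_le_mul_of_nonneg_left ?_ (by positivity)
  refine (Finset.abs_sum_le_sum_abs _ _).trans
    ((Finset.sum_le_sum fun m _ => abs_foldLoss_le hB hB0 _ _).trans ?_)
  simp

/-- The linear functional `t` of the scaled errors of the validation losses. -/
noncomputable def scaledError (ν : Measure 𝒵) (ℓ : 𝒵 → H → ℝ) (g : Fin J → Inducer 𝒵 H)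
    (t : Fin J → ℝ) (A : Fin J → Fin M → Finset (Fin n)) (z : Fin n → 𝒵) : ℝ :=
  ∑ j, t j * (√n * (validationLoss ℓ (g j) z (A j) - expectedRisk ν ℓ (g j) n))

/-- The contribution of one validation point to the linearization of `scaledError`. -/
noncomputable def linearTerm (ν : Measure 𝒵) (ℓ : 𝒵 → H → ℝ) (g : Fin J → Inducer 𝒵 H) (v : ℕ)
    (t : Fin J → ℝ) (A : Fin J → Fin M → Finset (Fin n)) (s : Fin n) (x : 𝒵) : ℝ :=
  ∑ j, t j * (√n * (useCount (A j) s / (M * v : ℝ) * pointwiseLoss ν ℓ (g j) (n - v) x))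

/-- The variance of the linearization of `scaledError` for fixed validation sets. -/
noncomputable def linearVariance (ν : Measure 𝒵) (ℓ : 𝒵 → H → ℝ) (g : Fin J → Inducer 𝒵 H) (v : ℕ)
    (t : Fin J → ℝ) (A : Fin J → Fin M → Finset (Fin n)) : ℝ :=
  ∑ i, ∑ j, t i * t j * ((n / (M * v : ℝ)) ^ 2 * ((overlap (A i) (A j) : ℝ) / n)
    * ∫ x, pointwiseLoss ν ℓ (g i) (n - v) x * pointwiseLoss ν ℓ (g j) (n - v) x ∂ν)

/-- After expanding the square, the products of use counts sum to overlaps; the factor `n / (Mv)²`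
is written as `(n / (Mv))² / n` so that both `n / (Mv)` and `overlap / n` have limits. -/
theorem sum_integral_linearTerm_sq (hB : ∀ z h, |ℓ z h| ≤ B)
    (hmeas : ∀ j n, Measurable fun p : 𝒵 × (Fin n → 𝒵) => ℓ p.1 (g j n p.2)) (t : Fin J → ℝ)
    (A : Fin J → Fin M → Finset (Fin n)) :
    ∑ s, ∫ x, linearTerm ν ℓ g v t A s x ^ 2 ∂ν = linearVariance ν ℓ g v t A := by
  have hint (i j : Fin J) : Integrable (fun x => pointwiseLoss ν ℓ (g i) (n - v) x
      * pointwiseLoss ν ℓ (g j) (n - v) x) ν := by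
    refine integrable_of_bounded ((measurable_pointwiseLoss ν hB (hmeas i) _).mul
      (measurable_pointwiseLoss ν hB (hmeas j) _)) (C := (2 * B) * (2 * B)) fun x => ?_
    rw [abs_mul]
    exact mul_le_mul (abs_pointwiseLoss_le ν hB _ _) (abs_pointwiseLoss_le ν hB _ _)
      (abs_nonneg _) ((abs_nonneg _).trans (abs_pointwiseLoss_le ν (g := g i) hB 0 x))
  have h1 (s : Fin n) : ∫ x, linearTerm ν ℓ g v t A s x ^ 2 ∂ν
      = ∑ i, ∑ j, t i * t j * (n / (M * v : ℝ) ^ 2 * (useCount (A i) s * useCount (A j) s)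
        * ∫ x, pointwiseLoss ν ℓ (g i) (n - v) x * pointwiseLoss ν ℓ (g j) (n - v) x ∂ν) := by
    have hsq (x) : linearTerm ν ℓ g v t A s x ^ 2
        = ∑ i, ∑ j, t i * t j * (n / (M * v : ℝ) ^ 2 * (useCount (A i) s * useCount (A j) s))
          * (pointwiseLoss ν ℓ (g i) (n - v) x * pointwiseLoss ν ℓ (g j) (n - v) x) := by
      rw [pow_two, linearTerm, Finset.sum_mul_sum]
      refine Finset.sum_congr rfl fun i _ => Finset.sum_congr rfl fun j _ => ?_
      linear_combination t i * t j * useCount (A i) s * useCount (A j) s / (M * v : ℝ) ^ 2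
        * pointwiseLoss ν ℓ (g i) (n - v) x * pointwiseLoss ν ℓ (g j) (n - v) x
        * Real.sq_sqrt (Nat.cast_nonneg n : (0 : ℝ) ≤ n)
    simp_rw [hsq]
    rw [integral_finsetSum _ fun i _ => integrable_finsetSum _ fun j _ => (hint i j).const_mul _]
    refine Finset.sum_congr rfl fun i _ => ?_
    rw [integral_finsetSum _ fun j _ => (hint i j).const_mul _]
    refine Finset.sum_congr rfl fun j _ => ?_
    rw [integral_const_mul]; ring
  simp_rw [h1]
  rw [Finset.sum_comm]
  refine Finset.sum_congr rfl fun i _ => ?_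
  rw [Finset.sum_comm]
  refine Finset.sum_congr rfl fun j _ => ?_
  rw [← Finset.mul_sum, ← Finset.sum_mul, ← Finset.mul_sum, sum_useCount_mul_useCount]
  rcases Nat.eq_zero_or_pos n with h | h
  · subst h; simp
  · have : (n : ℝ) ≠ 0 := by exact_mod_cast h.ne'
    congr 2
    rw [div_pow]
    field_simp

theorem linearVariance_nonneg (hB : ∀ z h, |ℓ z h| ≤ B)
    (hmeas : ∀ j n, Measurable fun p : 𝒵 × (Fin n → 𝒵) => ℓ p.1 (g j n p.2)) (t : Fin J → ℝ)
    (A : Fin J → Fin M → Finset (Fin n)) : 0 ≤ linearVariance ν ℓ g v t A := by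
  rw [← sum_integral_linearTerm_sq ν hB hmeas]
  exact Finset.sum_nonneg fun s _ => integral_nonneg fun x => sq_nonneg _

/-- A uniform bound for `linearTerm`. -/
noncomputable def linearTermBound (B : ℝ) (t : Fin J → ℝ) (n v : ℕ) : ℝ :=
  ∑ j, |t j| * (√n * (1 / v * (2 * B)))

/-- An observation is used at most `M` times, so its weight is at most `1 / v`. For `v` proportional
to `n` the bound is of order `1/√n`. -/
theorem abs_linearTerm_le (hB : ∀ z h, |ℓ z h| ≤ B) (hM : 0 < M) (t : Fin J → ℝ)
    (A : Fin J → Fin M → Finset (Fin n)) (s : Fin n) (x : 𝒵) :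
    |linearTerm ν ℓ g v t A s x| ≤ linearTermBound B t n v := by
  refine (Finset.abs_sum_le_sum_abs _ _).trans (Finset.sum_le_sum fun j _ => ?_)
  rw [abs_mul, abs_mul, abs_mul, abs_of_nonneg (Real.sqrt_nonneg _),
    abs_of_nonneg (by positivity : (0 : ℝ) ≤ useCount (A j) s / (M * v))]
  have h1 : (useCount (A j) s : ℝ) / (M * v) ≤ 1 / v := by
    have hM' : (0 : ℝ) < M := by exact_mod_cast hM
    have : (useCount (A j) s : ℝ) / M ≤ 1 := by
      rw [div_le_one hM']; exact_mod_cast useCount_le _ _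
    rw [← div_div]
    exact div_le_div_of_nonneg_right this (by positivity)
  gcongr
  exact abs_pointwiseLoss_le ν hB _ _

omit [IsProbabilityMeasure ν] in
theorem measurable_scaledError
    (hmeas : ∀ j n, Measurable fun p : 𝒵 × (Fin n → 𝒵) => ℓ p.1 (g j n p.2)) (t : Fin J → ℝ)
    (A : Fin J → Fin M → Finset (Fin n)) : Measurable (scaledError ν ℓ g t A) :=
  Finset.measurable_fun_sum _ fun j _ =>
    (((measurable_validationLoss (hmeas j) (A j)).sub_const _).const_mul _).const_mul _

theorem measurable_linearTerm (hB : ∀ z h, |ℓ z h| ≤ B)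
    (hmeas : ∀ j n, Measurable fun p : 𝒵 × (Fin n → 𝒵) => ℓ p.1 (g j n p.2)) (t : Fin J → ℝ)
    (A : Fin J → Fin M → Finset (Fin n)) (s : Fin n) : Measurable (linearTerm ν ℓ g v t A s) :=
  Finset.measurable_fun_sum _ fun j _ =>
    (((measurable_pointwiseLoss ν hB (hmeas j) _).const_mul _).const_mul _).const_mul _

theorem integral_linearTerm (hB : ∀ z h, |ℓ z h| ≤ B)
    (hmeas : ∀ j n, Measurable fun p : 𝒵 × (Fin n → 𝒵) => ℓ p.1 (g j n p.2)) (t : Fin J → ℝ)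
    (A : Fin J → Fin M → Finset (Fin n)) (s : Fin n) : ∫ x, linearTerm ν ℓ g v t A s x ∂ν = 0 := by
  unfold linearTerm
  rw [integral_finsetSum]
  · simp [integral_const_mul, integral_pointwiseLoss ν hB (hmeas _)]
  · exact fun j _ => (((integrable_of_bounded (measurable_pointwiseLoss ν hB (hmeas j) _)
      (fun x => abs_pointwiseLoss_le ν hB _ x)).const_mul _).const_mul _).const_mul _

/-- The error of the Gaussian approximation of the characteristic function of `scaledError`. -/
noncomputable def gaussianError (ν : Measure 𝒵) (ℓ : 𝒵 → H → ℝ) (g : Fin J → Inducer 𝒵 H) (B : ℝ)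
    (r t : Fin J → ℝ) (n v : ℕ) : ℝ :=
  ∑ j, |t j| * (√n * linearizationError ν ℓ (g j) (r j) n v)
    + n * (2 * linearTermBound B t n v ^ 3)

theorem integral_abs_scaledError_sub_le (hB : ∀ z h, |ℓ z h| ≤ B)
    (hmeas : ∀ j n, Measurable fun p : 𝒵 × (Fin n → 𝒵) => ℓ p.1 (g j n p.2))
    (hperm : ∀ j, (g j).PermInvariant) (r t : Fin J → ℝ) (hM : 0 < M) (hv : 0 < v)
    {A : Fin J → Fin M → Finset (Fin n)} (hA : ∀ j m, (A j m).card = v) :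
    ∫ z, |scaledError ν ℓ g t A z - ∑ s, linearTerm ν ℓ g v t A s (z s)| ∂(sampleLaw ν n)
      ≤ ∑ j, |t j| * (√n * linearizationError ν ℓ (g j) (r j) n v) := by
  set G : Fin J → (Fin n → 𝒵) → ℝ := fun j z =>
    validationLoss ℓ (g j) z (A j) - expectedRisk ν ℓ (g j) n
      - ∑ s, useCount (A j) s / (M * v : ℝ) * pointwiseLoss ν ℓ (g j) (n - v) (z s) with hG
  have hdec (z) : scaledError ν ℓ g t A z - ∑ s, linearTerm ν ℓ g v t A s (z s)
      = ∑ j, t j * (√n * G j z) := by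
    simp only [scaledError, linearTerm, hG]
    rw [Finset.sum_comm, ← Finset.sum_sub_distrib]
    refine Finset.sum_congr rfl fun j _ => ?_
    rw [← Finset.mul_sum, ← Finset.mul_sum]
    ring
  have hGi (j) : Integrable (G j) (sampleLaw ν n) := by
    refine ((integrable_validationLoss ν hB (hmeas j) (A j)).sub (integrable_const _)).sub
      (integrable_finsetSum _ fun s _ => Integrable.const_mul ?_ _)
    exact integrable_of_bounded ((measurable_pointwiseLoss ν hB (hmeas j) _).comp
      (measurable_pi_apply s)) fun z => abs_pointwiseLoss_le ν hB _ _
  simp_rw [hdec]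
  have hle : ∫ z, |∑ j, t j * (√n * G j z)| ∂(sampleLaw ν n)
      ≤ ∫ z, ∑ j, |t j| * (√n * |G j z|) ∂(sampleLaw ν n) := by
    refine integral_mono
      (integrable_finsetSum _ fun j _ => ((hGi j).const_mul _).const_mul _).abs
      (integrable_finsetSum _ fun j _ => ((hGi j).abs.const_mul _).const_mul _) fun z => ?_
    refine (Finset.abs_sum_le_sum_abs _ _).trans_eq (Finset.sum_congr rfl fun j _ => ?_)
    rw [abs_mul, abs_mul, abs_of_nonneg (Real.sqrt_nonneg _)]
  refine hle.trans ?_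
  rw [integral_finsetSum _ fun j _ => ((hGi j).abs.const_mul _).const_mul _]
  refine Finset.sum_le_sum fun j _ => ?_
  rw [integral_const_mul, integral_const_mul]
  have := integral_abs_validationLoss_sub_le ν hB (hmeas j) (hperm j) (r j) hM hv (hA j)
  gcongr

/-- The two parts of `gaussianError` are the linearization error in mean, passed on by the Lipschitz
bound for `exp (I * x)`, and the Gaussian approximation of the independent sum with `ε =
linearTermBound`. -/
theorem norm_integral_exp_scaledError_sub_le (hB : ∀ z h, |ℓ z h| ≤ B)
    (hmeas : ∀ j n, Measurable fun p : 𝒵 × (Fin n → 𝒵) => ℓ p.1 (g j n p.2))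
    (hperm : ∀ j, (g j).PermInvariant) (r t : Fin J → ℝ) (hM : 0 < M) (hv : 0 < v)
    (hbound : linearTermBound B t n v ≤ 1)
    {A : Fin J → Fin M → Finset (Fin n)} (hA : ∀ j m, (A j m).card = v) :
    ‖∫ z, Complex.exp (Complex.I * scaledError ν ℓ g t A z) ∂(sampleLaw ν n)
      - Complex.exp (-(linearVariance ν ℓ g v t A : ℂ) / 2)‖ ≤ gaussianError ν ℓ g B r t n v := by
  have hlm (s) := measurable_linearTerm (v := v) ν hB hmeas t A s
  have hL : Measurable fun z : Fin n → 𝒵 => ∑ s, linearTerm ν ℓ g v t A s (z s) :=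
    Finset.measurable_fun_sum _ fun s _ => (hlm s).comp (measurable_pi_apply s)
  have hS := measurable_scaledError ν hmeas t A
  have hexp {f : (Fin n → 𝒵) → ℝ} (hf : Measurable f) :
      Integrable (fun z => Complex.exp (Complex.I * f z)) (sampleLaw ν n) :=
    Integrable.of_bound (by fun_prop) 1 (.of_forall fun x => norm_exp_I_mul_le _)
  have h2 := norm_integral_exp_sum_sub_exp_le ν hlm hbound
    (fun s x => abs_linearTerm_le ν hB hM t A s x) (integral_linearTerm ν hB hmeas t A)
  rw [sum_integral_linearTerm_sq ν hB hmeas, Fintype.card_fin] at h2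
  have h1 : ‖∫ z, Complex.exp (Complex.I * scaledError ν ℓ g t A z) ∂(sampleLaw ν n)
      - ∫ z, Complex.exp (Complex.I * ((∑ s, linearTerm ν ℓ g v t A s (z s) : ℝ) : ℂ))
        ∂(sampleLaw ν n)‖ ≤ ∑ j, |t j| * (√n * linearizationError ν ℓ (g j) (r j) n v) := by
    rw [← integral_sub (hexp hS) (hexp hL)]
    have hi : Integrable (fun z => scaledError ν ℓ g t A z
        - ∑ s, linearTerm ν ℓ g v t A s (z s)) (sampleLaw ν n) := by
      refine Integrable.sub ?_ (integrable_finsetSum _ fun s _ => ?_)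
      · exact integrable_finsetSum _ fun j _ => (((integrable_validationLoss ν hB (hmeas j)
          (A j)).sub (integrable_const _)).const_mul _).const_mul _
      · exact integrable_of_bounded ((hlm s).comp (measurable_pi_apply s))
          fun z => abs_linearTerm_le ν hB hM t A s _
    exact (norm_integral_le_of_norm_le hi.abs
      (.of_forall fun z => norm_exp_I_mul_sub_le _ _)).trans
      (integral_abs_scaledError_sub_le ν hB hmeas hperm r t hM hv hA)
  have := (norm_add_le _ _).trans (add_le_add h1 h2)
  rwa [sub_add_sub_cancel] at this

/-- The characteristic function of `scaledError` for random validation sets, independent of the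
data. -/
theorem norm_integral_exp_scaledError_random_sub_le (hB : ∀ z h, |ℓ z h| ≤ B)
    (hmeas : ∀ j n, Measurable fun p : 𝒵 × (Fin n → 𝒵) => ℓ p.1 (g j n p.2))
    (hperm : ∀ j, (g j).PermInvariant) (r t : Fin J → ℝ) (hM : 0 < M) (hv : 0 < v)
    (hbound : linearTermBound B t n v ≤ 1)
    {Ω : Type*} [MeasurableSpace Ω] {P : Measure Ω} [IsProbabilityMeasure P]
    {I : Ω → Fin J → Fin M → Finset (Fin n)} (hI : Measurable I)
    {Z : Ω → Fin n → 𝒵} (hZ : HasLaw Z (sampleLaw ν n) P) (hind : IndepFun I Z P)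
    (hcard : ∀ᵐ ω ∂P, ∀ j m, (I ω j m).card = v) :
    ‖∫ ω, Complex.exp (Complex.I * scaledError ν ℓ g t (I ω) (Z ω)) ∂P
      - ∫ ω, Complex.exp (-(linearVariance ν ℓ g v t (I ω) : ℂ) / 2) ∂P‖
      ≤ gaussianError ν ℓ g B r t n v := by
  set Q := P.map I with hQ
  have : IsProbabilityMeasure Q := Measure.isProbabilityMeasure_map hI.aemeasurable
  -- By independence the validation sets can be frozen, so the bound for fixed sets integrates over
  -- their law.
  have hlaw : P.map (fun ω => (I ω, Z ω)) = Q.prod (sampleLaw ν n) := by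
    rw [(indepFun_iff_map_prod_eq_prod_map_map hI.aemeasurable hZ.aemeasurable).1 hind, hZ.map_eq]
  have hm : Measurable fun p : (Fin J → Fin M → Finset (Fin n)) × (Fin n → 𝒵) =>
      scaledError ν ℓ g t p.1 p.2 :=
    measurable_from_prod_countable_right fun A => measurable_scaledError ν hmeas t A
  have hmΦ : Measurable fun p : (Fin J → Fin M → Finset (Fin n)) × (Fin n → 𝒵) =>
      Complex.exp (Complex.I * scaledError ν ℓ g t p.1 p.2) := by fun_prop
  have hiΦ : Integrable (fun p : (Fin J → Fin M → Finset (Fin n)) × (Fin n → 𝒵) =>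
      Complex.exp (Complex.I * scaledError ν ℓ g t p.1 p.2)) (Q.prod (sampleLaw ν n)) :=
    Integrable.of_bound hmΦ.aestronglyMeasurable 1 (.of_forall fun p => norm_exp_I_mul_le _)
  have e1 : ∫ ω, Complex.exp (Complex.I * scaledError ν ℓ g t (I ω) (Z ω)) ∂P
      = ∫ A, ∫ z, Complex.exp (Complex.I * scaledError ν ℓ g t A z) ∂(sampleLaw ν n) ∂Q := by
    rw [← integral_prod _ hiΦ, ← hlaw, integral_map (hI.aemeasurable.prodMk hZ.aemeasurable)]
    exact hmΦ.aestronglyMeasurable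
  have e2 : ∫ ω, Complex.exp (-(linearVariance ν ℓ g v t (I ω) : ℂ) / 2) ∂P
      = ∫ A, Complex.exp (-(linearVariance ν ℓ g v t A : ℂ) / 2) ∂Q := by
    rw [integral_map hI.aemeasurable]
    exact (Measurable.of_discrete).aestronglyMeasurable
  have hi2 : Integrable (fun A : Fin J → Fin M → Finset (Fin n) =>
      Complex.exp (-(linearVariance ν ℓ g v t A : ℂ) / 2)) Q := Integrable.of_finite
  rw [e1, e2, ← integral_sub hiΦ.integral_prod_left hi2]
  have hae : ∀ᵐ A ∂Q, ∀ j m, (A j m).card = v := by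
    rw [hQ, ae_map_iff hI.aemeasurable .of_discrete]; exact hcard
  have hb := norm_integral_le_of_norm_le_const (hae.mono fun A hA =>
    norm_integral_exp_scaledError_sub_le ν hB hmeas hperm r t hM hv hbound hA)
  simpa using hb

end FixedSampleSize

/-! ### Asymptotics of the error terms -/

section Limits

variable {α : ℝ}

theorem ceil_mul_le (hα1 : α < 1) (n : ℕ) : ⌈α * n⌉₊ ≤ n := by
  rw [Nat.ceil_le]
  nlinarith [(Nat.cast_nonneg n : (0 : ℝ) ≤ n)]

theorem tendsto_ceil_mul_div (hα0 : 0 < α) :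
    Tendsto (fun n : ℕ => (⌈α * n⌉₊ : ℝ) / n) atTop (𝓝 α) :=
  (tendsto_nat_ceil_mul_div_atTop hα0.le).comp tendsto_natCast_atTop_atTop

theorem tendsto_div_ceil_mul (hα0 : 0 < α) :
    Tendsto (fun n : ℕ => (n : ℝ) / ⌈α * n⌉₊) atTop (𝓝 α⁻¹) := by
  simpa using (tendsto_ceil_mul_div hα0).inv₀ hα0.ne'

theorem tendsto_sub_ceil_mul_div (hα0 : 0 < α) (hα1 : α < 1) :
    Tendsto (fun n : ℕ => ((n - ⌈α * n⌉₊ : ℕ) : ℝ) / n) atTop (𝓝 (1 - α)) := by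
  refine ((tendsto_const_nhds (x := (1 : ℝ))).sub (tendsto_ceil_mul_div hα0)).congr' ?_
  filter_upwards [eventually_gt_atTop 0] with n hn
  have : (n : ℝ) ≠ 0 := by exact_mod_cast hn.ne'
  rw [Nat.cast_sub (ceil_mul_le hα1 n), sub_div, div_self this]

theorem tendsto_sub_ceil_mul (hα0 : 0 < α) (hα1 : α < 1) :
    Tendsto (fun n : ℕ => n - ⌈α * n⌉₊) atTop atTop := by
  rw [← tendsto_natCast_atTop_iff (R := ℝ)]
  have h := Tendsto.pos_mul_atTop (by linarith : 0 < 1 - α) (tendsto_sub_ceil_mul_div hα0 hα1)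
    (tendsto_natCast_atTop_atTop (R := ℝ))
  refine h.congr' ?_
  filter_upwards [eventually_gt_atTop 0] with n hn
  have : (n : ℝ) ≠ 0 := by exact_mod_cast hn.ne'
  field_simp

theorem tendsto_mul_of_isLittleO_inv {f : ℕ → ℝ}
    (h : f =o[atTop] fun n : ℕ => 1 / (n : ℝ)) :
    Tendsto (fun n : ℕ => (n : ℝ) * f n) atTop (𝓝 0) := by
  refine h.tendsto_div_nhds_zero.congr fun n => ?_
  rw [div_div_eq_mul_div, div_one, mul_comm]

theorem tendsto_sqrt_mul_of_isLittleO_inv_sqrt {f : ℕ → ℝ}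
    (h : f =o[atTop] fun n : ℕ => 1 / √(n : ℝ)) :
    Tendsto (fun n : ℕ => √(n : ℝ) * f n) atTop (𝓝 0) := by
  refine h.tendsto_div_nhds_zero.congr fun n => ?_
  rw [div_div_eq_mul_div, div_one, mul_comm]

variable {𝒵 H : Type*} [MeasurableSpace 𝒵] (ν : Measure 𝒵) {ℓ : 𝒵 → H → ℝ}

/-- With `N = n - ⌈αn⌉`, the ratios `n / ⌈αn⌉` and `n / N` converge to `1/α` and `1/(1-α)`. Hence
the stability rates at training size `N` become rates in `n`. -/
theorem tendsto_sqrt_mul_linearizationError (hα0 : 0 < α) (hα1 : α < 1) {g : Inducer 𝒵 H} {r : ℝ}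
    (hloss : LossStable ν ℓ g)
    (hrisk : (fun n : ℕ => ∫ T, |risk ν ℓ (g n T) - r| ∂(sampleLaw ν n))
      =o[atTop] (fun n : ℕ => 1 / √(n : ℝ))) :
    Tendsto (fun n : ℕ => √(n : ℝ) * linearizationError ν ℓ g r n ⌈α * n⌉₊) atTop (𝓝 0) := by
  set N : ℕ → ℕ := fun n => n - ⌈α * n⌉₊ with hN
  have hNt : Tendsto N atTop atTop := tendsto_sub_ceil_mul hα0 hα1
  have t1 := ((tendsto_div_ceil_mul hα0).mul
    (((tendsto_mul_of_isLittleO_inv hloss).comp hNt).div_const 2)).sqrt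
  have t2 := ((tendsto_sub_ceil_mul_div hα0 hα1).inv₀ (by linarith)).sqrt.mul
    ((tendsto_sqrt_mul_of_isLittleO_inv_sqrt hrisk).comp hNt)
  have t3 := tendsto_sqrt_mul_of_isLittleO_inv_sqrt hrisk
  have t := (t1.add t2).add t3
  simp only [zero_div, mul_zero, Real.sqrt_zero, add_zero] at t
  refine t.congr' ?_
  filter_upwards [hNt.eventually_gt_atTop 0] with n hn
  have hN0 : (0 : ℝ) < N n := by exact_mod_cast hn
  simp only [linearizationError, mul_add, Function.comp_apply]
  congr 2
  · rw [← Real.sqrt_mul (Nat.cast_nonneg n)]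
    congr 1
    change _ = (n : ℝ) * ((N n : ℝ) / 2 * lossInstability ν ℓ g (N n) / _)
    ring
  · rw [← mul_assoc, ← Real.sqrt_mul (by positivity)]
    congr 2
    change ((N n : ℝ) / n)⁻¹ * N n = n
    rw [inv_div]
    field_simp

theorem tendsto_sqrt_mul_linearTermBound (hα0 : 0 < α) {J : ℕ} (B : ℝ) (t : Fin J → ℝ) :
    Tendsto (fun n : ℕ => √(n : ℝ) * linearTermBound B t n ⌈α * n⌉₊) atTop
      (𝓝 (∑ j, |t j| * (α⁻¹ * (2 * B)))) := by
  have := tendsto_finsetSum Finset.univ fun j _ =>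
    (((tendsto_div_ceil_mul hα0).mul_const (2 * B)).const_mul |t j|)
  refine this.congr fun n => ?_
  rw [linearTermBound, Finset.mul_sum]
  refine Finset.sum_congr rfl fun j _ => ?_
  have := Real.sq_sqrt (Nat.cast_nonneg n : (0 : ℝ) ≤ n)
  rw [div_eq_mul_inv, one_div]
  linear_combination (- |t j| * (⌈α * n⌉₊ : ℝ)⁻¹ * 2 * B) * this

theorem tendsto_linearTermBound (hα0 : 0 < α) {J : ℕ} (B : ℝ) (t : Fin J → ℝ) :
    Tendsto (fun n : ℕ => linearTermBound B t n ⌈α * n⌉₊) atTop (𝓝 0) := by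
  have h := (tendsto_inv_atTop_zero.comp (Real.tendsto_sqrt_atTop.comp
    (tendsto_natCast_atTop_atTop (R := ℝ)))).mul (tendsto_sqrt_mul_linearTermBound hα0 B t)
  rw [zero_mul] at h
  refine h.congr' ?_
  filter_upwards [eventually_gt_atTop 0] with n hn
  have : √(n : ℝ) ≠ 0 := (Real.sqrt_pos.2 (by exact_mod_cast hn)).ne'
  simp only [Function.comp_apply]
  field_simp

theorem tendsto_gaussianError (hα0 : 0 < α) (hα1 : α < 1) {J : ℕ} {g : Fin J → Inducer 𝒵 H}
    {r : Fin J → ℝ} (B : ℝ) (t : Fin J → ℝ)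
    (hloss : ∀ j, LossStable ν ℓ (g j))
    (hrisk : ∀ j, (fun n : ℕ => ∫ T, |risk ν ℓ (g j n T) - r j| ∂(sampleLaw ν n))
      =o[atTop] (fun n : ℕ => 1 / √(n : ℝ))) :
    Tendsto (fun n : ℕ => gaussianError ν ℓ g B r t n ⌈α * n⌉₊) atTop (𝓝 0) := by
  have h1 := tendsto_finsetSum Finset.univ fun j _ =>
    (tendsto_sqrt_mul_linearizationError ν hα0 hα1 (hloss j) (hrisk j)).const_mul |t j|
  -- With `ε = linearTermBound`, `n ε³ = (√n ε)² ε` is a convergent factor times a null one.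
  have h2 := (((tendsto_sqrt_mul_linearTermBound hα0 B t).pow 2).mul
    (tendsto_linearTermBound hα0 B t)).const_mul 2
  have h := h1.add h2
  simp only [mul_zero, Finset.sum_const_zero, add_zero] at h
  refine h.congr fun n => ?_
  have := Real.sq_sqrt (Nat.cast_nonneg n : (0 : ℝ) ≤ n)
  rw [gaussianError, mul_pow, this]
  ring

end Limits

/-! ### Concentration of the conditional variance -/

section Variance

variable {𝒵 H : Type*} [MeasurableSpace 𝒵] (ν : Measure 𝒵) [IsProbabilityMeasure ν]
  {ℓ : 𝒵 → H → ℝ}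

theorem integrable_comp_of_finite {Ω A : Type*} [MeasurableSpace Ω] {P : Measure Ω}
    [IsFiniteMeasure P] [MeasurableSpace A] [Finite A] [MeasurableSingletonClass A] {I : Ω → A}
    (hI : Measurable I) (f : A → ℝ) : Integrable (fun ω => f (I ω)) P :=
  (Integrable.of_finite (μ := P.map I) (f := f)).comp_measurable hI

theorem covariance_pointwiseLoss {B : ℝ} (hB : ∀ z h, |ℓ z h| ≤ B) {g g' : Inducer 𝒵 H}
    (hmeas : ∀ n, Measurable fun p : 𝒵 × (Fin n → 𝒵) => ℓ p.1 (g n p.2))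
    (hmeas' : ∀ n, Measurable fun p : 𝒵 × (Fin n → 𝒵) => ℓ p.1 (g' n p.2)) (n : ℕ) :
    cov[pointwiseLoss ν ℓ g n, pointwiseLoss ν ℓ g' n; ν]
      = ∫ x, pointwiseLoss ν ℓ g n x * pointwiseLoss ν ℓ g' n x ∂ν := by
  simp [covariance, integral_pointwiseLoss ν hB hmeas, integral_pointwiseLoss ν hB hmeas']

theorem integral_overlap {Ω : Type*} [MeasurableSpace Ω] {P : Measure Ω} [IsProbabilityMeasure P]
    {J M n : ℕ} {I : Ω → Fin J → Fin M → Finset (Fin n)} (hI : Measurable I) (i j : Fin J) :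
    ∫ ω, (overlap (I ω i) (I ω j) : ℝ) ∂P
      = ∑ s : Fin n, ∑ m : Fin M, ∑ m' : Fin M, P.real {ω | s ∈ I ω i m ∩ I ω j m'} := by
  have hset (s : Fin n) (m m' : Fin M) : MeasurableSet {ω | s ∈ I ω i m ∩ I ω j m'} :=
    hI (MeasurableSet.of_discrete (s := {A : Fin J → Fin M → Finset (Fin n) | s ∈ A i m ∩ A j m'}))
  have e (ω) : (overlap (I ω i) (I ω j) : ℝ) = ∑ s : Fin n, ∑ m : Fin M, ∑ m' : Fin M,
      Set.indicator {ω | s ∈ I ω i m ∩ I ω j m'} (fun _ => (1 : ℝ)) ω := by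
    rw [overlap, Finset.sum_comm]
    push_cast
    rw [Finset.sum_comm]
    conv_rhs => rw [Finset.sum_comm]
    refine Finset.sum_congr rfl fun m _ => ?_
    conv_rhs => rw [Finset.sum_comm]
    refine Finset.sum_congr rfl fun m' _ => ?_
    simp [Set.indicator_apply]
    congr 1
    ext s
    simp
  have hint (s : Fin n) (m m' : Fin M) : Integrable
      (Set.indicator {ω | s ∈ I ω i m ∩ I ω j m'} (fun _ => (1 : ℝ))) P :=
    (integrable_const _).indicator (hset s m m')
  simp_rw [e]
  rw [integral_finsetSum _ fun s _ => integrable_finsetSum _ fun m _ =>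
    integrable_finsetSum _ fun m' _ => hint s m m']
  refine Finset.sum_congr rfl fun s _ => ?_
  rw [integral_finsetSum _ fun m _ => integrable_finsetSum _ fun m' _ => hint s m m']
  refine Finset.sum_congr rfl fun m _ => ?_
  rw [integral_finsetSum _ fun m' _ => hint s m m']
  refine Finset.sum_congr rfl fun m' _ => ?_
  rw [integral_indicator_const _ (hset s m m')]
  simp

omit [IsProbabilityMeasure ν] in
/-- The conditional variance of the linearization concentrates in mean if the overlaps of the
validation sets do. -/
theorem integral_abs_linearVariance_sub_le {J M n v : ℕ} {g : Fin J → Inducer 𝒵 H}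
    {Ω : Type*} [MeasurableSpace Ω] {P : Measure Ω} [IsProbabilityMeasure P]
    {I : Ω → Fin J → Fin M → Finset (Fin n)} (hI : Measurable I) (t : Fin J → ℝ)
    (L c : Fin J → Fin J → ℝ)
    (hc : ∀ i j, c i j = (n / (M * v : ℝ)) ^ 2
      * ∫ x, pointwiseLoss ν ℓ (g i) (n - v) x * pointwiseLoss ν ℓ (g j) (n - v) x ∂ν) :
    ∫ ω, |linearVariance ν ℓ g v t (I ω) - ∑ i, ∑ j, t i * t j * L i j| ∂P
      ≤ ∑ i, ∑ j, |t i * t j| * (|c i j| * √(Var[fun ω => (overlap (I ω i) (I ω j) : ℝ) / n; P])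
        + |c i j * (∫ ω, (overlap (I ω i) (I ω j) : ℝ) / n ∂P) - L i j|) := by
  set U : Fin J → Fin J → Ω → ℝ := fun i j ω => (overlap (I ω i) (I ω j) : ℝ) / n with hU
  have hUi (i j) (f : ℝ → ℝ) : Integrable (fun ω => f (U i j ω)) P :=
    integrable_comp_of_finite hI fun A => f ((overlap (A i) (A j) : ℝ) / n)
  have hdev (i j) : ∫ ω, |U i j ω - ∫ ω', U i j ω' ∂P| ∂P ≤ √(Var[U i j; P]) := by
    have hm : AEMeasurable (U i j) P := (hUi i j id).aemeasurable
    rw [variance_eq_integral hm]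
    exact integral_abs_le_sqrt (hUi i j fun x => x - ∫ ω', U i j ω' ∂P)
      (hUi i j fun x => (x - ∫ ω', U i j ω' ∂P) ^ 2)
  have hint (i j) : Integrable (fun ω => |t i * t j| * (|c i j| * |U i j ω - ∫ ω', U i j ω' ∂P|
        + |c i j * (∫ ω', U i j ω' ∂P) - L i j|)) P :=
    hUi i j fun x => |t i * t j| * (|c i j| * |x - ∫ ω', U i j ω' ∂P|
        + |c i j * (∫ ω', U i j ω' ∂P) - L i j|)
  have hle : ∫ ω, |linearVariance ν ℓ g v t (I ω) - ∑ i, ∑ j, t i * t j * L i j| ∂P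
      ≤ ∫ ω, ∑ i, ∑ j, |t i * t j| * (|c i j| * |U i j ω - ∫ ω', U i j ω' ∂P|
        + |c i j * (∫ ω', U i j ω' ∂P) - L i j|) ∂P := by
    refine integral_mono (integrable_comp_of_finite hI fun A =>
      |linearVariance ν ℓ g v t A - ∑ i, ∑ j, t i * t j * L i j|)
      (integrable_finsetSum _ fun i _ => integrable_finsetSum _ fun j _ => hint i j) fun ω => ?_
    dsimp only
    rw [linearVariance, ← Finset.sum_sub_distrib]
    refine (Finset.abs_sum_le_sum_abs _ _).trans (Finset.sum_le_sum fun i _ => ?_)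
    rw [← Finset.sum_sub_distrib]
    refine (Finset.abs_sum_le_sum_abs _ _).trans (Finset.sum_le_sum fun j _ => ?_)
    rw [← mul_sub, abs_mul]
    refine mul_le_mul_of_nonneg_left ?_ (abs_nonneg _)
    rw [← abs_mul]
    -- With `U = overlap / n`: `c U - L = c (U - E U) + (c E U - L)`.
    refine le_trans (le_of_eq ?_) (abs_add_le _ _)
    congr 1
    rw [hc i j]
    ring
  refine hle.trans ?_
  rw [integral_finsetSum _ fun i _ => integrable_finsetSum _ fun j _ => hint i j]
  refine Finset.sum_le_sum fun i _ => ?_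
  rw [integral_finsetSum _ fun j _ => hint i j]
  refine Finset.sum_le_sum fun j _ => ?_
  rw [integral_const_mul]
  refine mul_le_mul_of_nonneg_left ?_ (abs_nonneg _)
  rw [integral_add (hUi i j fun x => |c i j| * |x - ∫ ω', U i j ω' ∂P|) (integrable_const _),
    integral_const_mul]
  simp only [integral_const, probReal_univ, one_smul]
  exact add_le_add (mul_le_mul_of_nonneg_left (hdev i j) (abs_nonneg _)) le_rfl

end Variance

/-! ### Auxiliary facts for the main theorem -/

section Assembly

theorem hasLaw_sample {𝒵 Ω : Type*} [MeasurableSpace 𝒵] {ν : Measure 𝒵} [IsProbabilityMeasure ν]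
    [MeasurableSpace Ω] {P : Measure Ω} [IsProbabilityMeasure P] {n : ℕ} {Z : Fin n → Ω → 𝒵}
    (hZ : ∀ i, HasLaw (Z i) ν P) (hind : iIndepFun Z P) :
    HasLaw (fun ω i => Z i ω) (sampleLaw ν n) P where
  aemeasurable := aemeasurable_pi_lambda _ fun i => (hZ i).aemeasurable
  map_eq := by
    rw [(iIndepFun_iff_map_fun_eq_pi_map fun i => (hZ i).aemeasurable).1 hind]
    simp_rw [(hZ _).map_eq]

theorem dotProduct_of_mulVec {J : ℕ} (L : Fin J → Fin J → ℝ) (x : Fin J → ℝ) :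
    dotProduct x (Matrix.mulVec (Matrix.of L) x) = ∑ i, ∑ j, x i * x j * L i j := by
  simp only [dotProduct, Matrix.mulVec, Matrix.of_apply, Finset.mul_sum]
  exact Finset.sum_congr rfl fun i _ => Finset.sum_congr rfl fun j _ => by ring

/-- Needed for limits along `S` to be unique and to inherit inequalities. -/
theorem neBot_atTop_inf_principal {S : Set ℕ} (hS : S.Infinite) : (atTop ⊓ 𝓟 S).NeBot :=
  Filter.inf_principal_neBot_iff.2 fun _ hU =>
    ((Nat.frequently_atTop_iff_infinite.2 hS).and_eventually hU).exists.imp fun _ h => ⟨h.2, h.1⟩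

end Assembly

end Resampling

/-! ### The central limit theorem -/

open Resampling

theorem theorem1
    {𝒵 H Λ : Type*} [MeasurableSpace 𝒵]
    -- the law of one observation, the loss, the inducers, the hyperparameter configurations
    (ν : Measure 𝒵) [IsProbabilityMeasure ν]
    (ℓ : 𝒵 → H → ℝ) (g : Λ → Resampling.Inducer 𝒵 H) {J : ℕ} (lam : Fin J → Λ)
    -- regularity of loss and inducers
    (hbdd : ∃ B : ℝ, ∀ z h, |ℓ z h| ≤ B)
    (hmeas : ∀ (j : Fin J) (n : ℕ),
      Measurable (fun p : 𝒵 × (Fin n → 𝒵) => ℓ p.1 (g (lam j) n p.2)))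
    (hperm : ∀ j : Fin J, (g (lam j)).PermInvariant)
    (hloss : ∀ j : Fin J, Resampling.LossStable ν ℓ (g (lam j)))
    (hrisk : ∀ j : Fin J, Resampling.RiskStable ν ℓ (g (lam j)))
    -- the limiting covariance of the centered pointwise losses
    (K : Fin J → Fin J → ℝ)
    (hK : ∀ i j : Fin J, Tendsto
      (fun n : ℕ => cov[Resampling.pointwiseLoss ν ℓ (g (lam i)) n,
        Resampling.pointwiseLoss ν ℓ (g (lam j)) n; ν]) atTop (𝓝 (K i j)))
    -- for each sample size `n`: i.i.d. data `Z n`, and validation index sets `I n ω j m`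
    -- independent of the data
    {Ω : ℕ → Type*} [∀ n, MeasurableSpace (Ω n)]
    (P : (n : ℕ) → Measure (Ω n)) [∀ n, IsProbabilityMeasure (P n)]
    (Z : (n : ℕ) → Fin n → Ω n → 𝒵)
    (hZlaw : ∀ n i, HasLaw (Z n i) ν (P n))
    (hZindep : ∀ n, iIndepFun (Z n) (P n))
    {M : ℕ} (hM : 0 < M) (α : ℝ) (hα0 : 0 < α) (hα1 : α < 1)
    (I : (n : ℕ) → Ω n → Fin J → Fin M → Finset (Fin n))
    (hImeas : ∀ n, Measurable (I n))
    (hIindep : ∀ n, IndepFun (I n) (fun ω i => Z n i ω) (P n))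
    -- the sample sizes that are considered (all of them, or e.g. the multiples of `M`)
    (S : Set ℕ) (hS : S.Infinite)
    (hIcard : ∀ n ∈ S, ∀ j m, ∀ᵐ ω ∂(P n), (I n ω j m).card = ⌈α * n⌉₊)
    -- the limiting overlap probabilities, and the concentration of the overlaps
    (τ : Fin J → Fin J → ℝ)
    (hτ : ∀ i j : Fin J, Tendsto
      (fun n : ℕ => 1 / (n * (M : ℝ) ^ 2 * α ^ 2) *
        ∑ s : Fin n, ∑ m : Fin M, ∑ m' : Fin M, (P n).real {ω | s ∈ I n ω i m ∩ I n ω j m'})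
      (atTop ⊓ 𝓟 S) (𝓝 (τ i j)))
    (hconc : ∀ i j : Fin J, Tendsto
      (fun n : ℕ => Var[fun ω => (Resampling.overlap (I n ω i) (I n ω j) : ℝ) / n; P n])
      (atTop ⊓ 𝓟 S) (𝓝 0)) :
    (Matrix.of fun i j => τ i j * K i j).PosSemidef ∧
    TendstoInDistribution
      (fun (n : ℕ) (ω : Ω n) => WithLp.toLp 2 (fun j : Fin J =>
        Real.sqrt n *
          (Resampling.validationLoss ℓ (g (lam j)) (fun i => Z n i ω) (I n ω j)
            - Resampling.expectedRisk ν ℓ (g (lam j)) n)))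
      (atTop ⊓ 𝓟 S)
      (id : EuclideanSpace ℝ (Fin J) → EuclideanSpace ℝ (Fin J))
      P
      (multivariateGaussian 0 (Matrix.of fun i j => τ i j * K i j)) := by
  obtain ⟨B, hB⟩ := hbdd
  choose gstar _ hρ using hrisk
  set r : Fin J → ℝ := fun j => risk ν ℓ (gstar j) with hr
  set G : Fin J → Inducer 𝒵 H := fun j => g (lam j) with hG
  set l : Filter ℕ := atTop ⊓ 𝓟 S with hl
  have hlT : l ≤ atTop := inf_le_left
  have hlS : ∀ᶠ n in l, n ∈ S := Filter.eventually_inf_principal.2 (.of_forall fun _ h => h)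
  have hlne : l.NeBot := neBot_atTop_inf_principal hS
  set v : ℕ → ℕ := fun n => ⌈α * n⌉₊ with hv
  have hM' : (M : ℝ) ≠ 0 := by exact_mod_cast hM.ne'
  have hZ (n) : HasLaw (fun ω i => Z n i ω) (sampleLaw ν n) (P n) :=
    hasLaw_sample (hZlaw n) (hZindep n)
  set L : Fin J → Fin J → ℝ := fun i j => τ i j * K i j with hL
  set c : ℕ → Fin J → Fin J → ℝ := fun n i j => (n / (M * v n : ℝ)) ^ 2
      * ∫ x, pointwiseLoss ν ℓ (G i) (n - v n) x * pointwiseLoss ν ℓ (G j) (n - v n) x ∂ν with hc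
  -- The models are trained on `n - v n` points, so `hK` is used along that sequence, which tends to
  -- infinity because `α < 1`. The factor `(M * α)⁻¹ ^ 2` cancels against the limit in `hmean`,
  -- leaving `τ i j * K i j`.
  have hclim (i j) : Tendsto (fun n => c n i j) l (𝓝 ((M * α)⁻¹ ^ 2 * K i j)) := by
    have h1 := ((tendsto_div_ceil_mul hα0).const_mul (M : ℝ)⁻¹).pow 2
    have h2 := (hK i j).comp (tendsto_sub_ceil_mul hα0 hα1)
    have h := h1.mul h2
    rw [← mul_inv] at h
    refine (h.congr fun n => ?_).mono_left hlT
    simp only [hc, Function.comp_apply, covariance_pointwiseLoss ν hB (hmeas i) (hmeas j)]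
    congr 2
    simp only [hv, div_eq_mul_inv, mul_inv]
    ring
  have hmean (i j) : Tendsto (fun n => ∫ ω, (overlap (I n ω i) (I n ω j) : ℝ) / n ∂(P n)) l
      (𝓝 (τ i j * (M * α) ^ 2)) := by
    refine ((hτ i j).mul_const _).congr fun n => ?_
    rw [integral_div, integral_overlap (hImeas n)]
    field_simp
  have hvar (t : Fin J → ℝ) : Tendsto (fun n => ∫ ω, |linearVariance ν ℓ G (v n) t (I n ω)
      - ∑ i, ∑ j, t i * t j * L i j| ∂(P n)) l (𝓝 0) := by
    have hlim : Tendsto (fun n => ∑ i, ∑ j, |t i * t j| * (|c n i j|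
        * √(Var[fun ω => (overlap (I n ω i) (I n ω j) : ℝ) / n; P n])
        + |c n i j * (∫ ω, (overlap (I n ω i) (I n ω j) : ℝ) / n ∂(P n)) - L i j|)) l (𝓝 0) := by
      have h (i j) := (((hclim i j).abs.mul (hconc i j).sqrt).add
        (((hclim i j).mul (hmean i j)).sub_const (L i j)).abs).const_mul |t i * t j|
      have h' := tendsto_finsetSum Finset.univ fun i _ =>
        tendsto_finsetSum Finset.univ fun j _ => h i j
      refine h'.trans_eq ?_
      congr 1
      refine Finset.sum_eq_zero fun i _ => Finset.sum_eq_zero fun j _ => ?_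
      have : ((M : ℝ) * α)⁻¹ ^ 2 * K i j * (τ i j * (M * α) ^ 2) - L i j = 0 := by
        simp only [hL]; field_simp; ring
      rw [this]
      simp
    exact squeeze_zero (fun n => integral_nonneg fun ω => abs_nonneg _)
      (fun n => integral_abs_linearVariance_sub_le ν (hImeas n) t L (c n) fun i j => rfl) hlim
  have hLVi (t : Fin J → ℝ) (n) : Integrable (fun ω => linearVariance ν ℓ G (v n) t (I n ω)) (P n) :=
    integrable_comp_of_finite (hImeas n) fun A => linearVariance ν ℓ G (v n) t A
  have hq0 (t : Fin J → ℝ) : 0 ≤ ∑ i, ∑ j, t i * t j * L i j := by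
    have h : Tendsto (fun n => ∫ ω, linearVariance ν ℓ G (v n) t (I n ω) ∂(P n)) l
        (𝓝 (∑ i, ∑ j, t i * t j * L i j)) := by
      rw [tendsto_iff_norm_sub_tendsto_zero]
      refine squeeze_zero (fun n => norm_nonneg _) (fun n => ?_) (hvar t)
      have e : ∫ ω, linearVariance ν ℓ G (v n) t (I n ω) ∂(P n) - ∑ i, ∑ j, t i * t j * L i j
          = ∫ ω, (linearVariance ν ℓ G (v n) t (I n ω) - ∑ i, ∑ j, t i * t j * L i j) ∂(P n) := by
        rw [integral_sub (hLVi t n) (integrable_const _)]; simp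
      rw [e]
      exact abs_integral_le_integral_abs
    exact ge_of_tendsto' h fun n =>
      integral_nonneg fun ω => linearVariance_nonneg ν hB hmeas t _
  -- `K` and `τ` are known only as limits, so their symmetry comes from uniqueness of limits.
  have hsymm (i j) : L j i = L i j := by
    have hKs : K j i = K i j := by
      refine tendsto_nhds_unique (hK j i) ((hK i j).congr fun n => ?_)
      exact covariance_comm _ _
    have hτs : τ j i = τ i j := by
      have h1 := hmean j i
      have h2 := hmean i j
      have h3 : τ j i * (M * α) ^ 2 = τ i j * (M * α) ^ 2 := by
        refine tendsto_nhds_unique h1 (h2.congr fun n => ?_)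
        congr 1; ext ω
        congr 2
        unfold overlap
        rw [Finset.sum_comm]
        simp_rw [Finset.inter_comm]
      exact mul_right_cancel₀ (pow_ne_zero 2 (mul_ne_zero hM' hα0.ne')) h3
    simp only [hL, hKs, hτs]
  have hpsd : (Matrix.of fun i j => τ i j * K i j).PosSemidef := by
    refine Matrix.PosSemidef.of_dotProduct_mulVec_nonneg ?_ fun x => ?_
    · ext i j
      simpa using hsymm i j
    · rw [star_trivial, dotProduct_of_mulVec]
      exact hq0 x
  refine ⟨hpsd, ?_⟩
  have hchar (t : Fin J → ℝ) : Tendsto (fun n => ∫ ω, Complex.exp (Complex.I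
      * scaledError ν ℓ G t (I n ω) (fun i => Z n i ω)) ∂(P n)) l
      (𝓝 (Complex.exp (-((∑ i, ∑ j, t i * t j * L i j : ℝ) : ℂ) / 2))) := by
    have hlim := ((tendsto_gaussianError ν hα0 hα1 B t hloss hρ).mono_left hlT).add
      ((hvar t).div_const 2)
    rw [zero_div, add_zero] at hlim
    rw [tendsto_iff_norm_sub_tendsto_zero]
    refine squeeze_zero' (.of_forall fun n => norm_nonneg _) ?_ hlim
    filter_upwards [hlS, hlT (eventually_gt_atTop 0),
      hlT ((tendsto_linearTermBound hα0 B t).eventually_le_const zero_lt_one)] with n hnS hn0 hnb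
    have hvn : 0 < v n := Nat.ceil_pos.2 (mul_pos hα0 (by exact_mod_cast hn0))
    have hcard : ∀ᵐ ω ∂(P n), ∀ j m, (I n ω j m).card = v n := by
      rw [ae_all_iff]; intro j; rw [ae_all_iff]; exact hIcard n hnS j
    have h1 := norm_integral_exp_scaledError_random_sub_le ν hB hmeas hperm r t hM hvn hnb
      (hImeas n) (hZ n) (hIindep n) hcard
    -- The conditional variance is still random; `x ↦ exp(-x/2)` is `1/2`-Lipschitz on `x ≥ 0`, so
    -- convergence in mean suffices to replace it by its limit.
    have h2 : ‖∫ ω, Complex.exp (-(linearVariance ν ℓ G (v n) t (I n ω) : ℂ) / 2) ∂(P n)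
        - Complex.exp (-((∑ i, ∑ j, t i * t j * L i j : ℝ) : ℂ) / 2)‖
        ≤ (∫ ω, |linearVariance ν ℓ G (v n) t (I n ω)
          - ∑ i, ∑ j, t i * t j * L i j| ∂(P n)) / 2 := by
      have hie : Integrable (fun ω => Real.exp (-linearVariance ν ℓ G (v n) t (I n ω) / 2)) (P n) :=
        integrable_comp_of_finite (hImeas n)
          fun A => Real.exp (-linearVariance ν ℓ G (v n) t A / 2)
      have e : ∫ ω, Complex.exp (-(linearVariance ν ℓ G (v n) t (I n ω) : ℂ) / 2) ∂(P n)
          - Complex.exp (-((∑ i, ∑ j, t i * t j * L i j : ℝ) : ℂ) / 2)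
          = ((∫ ω, (Real.exp (-linearVariance ν ℓ G (v n) t (I n ω) / 2)
            - Real.exp (-(∑ i, ∑ j, t i * t j * L i j) / 2)) ∂(P n) : ℝ) : ℂ) := by
        rw [integral_sub hie (integrable_const _), Complex.ofReal_sub, ← integral_complex_ofReal]
        simp
      rw [e, Complex.norm_real, ← integral_div]
      refine norm_integral_le_of_norm_le
        (((hLVi t n).sub (integrable_const _)).abs.div_const 2) (.of_forall fun ω => ?_)
      exact abs_exp_neg_half_sub_le (linearVariance_nonneg ν hB hmeas t _) (hq0 t)
    have h := (norm_add_le _ _).trans (add_le_add h1 h2)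
    rwa [sub_add_sub_cancel] at h
  have hX (n : ℕ) : AEMeasurable (fun ω => WithLp.toLp 2 (fun j : Fin J => √n *
      (validationLoss ℓ (g (lam j)) (fun i => Z n i ω) (I n ω j)
        - expectedRisk ν ℓ (g (lam j)) n))) (P n) := by
    refine (WithLp.measurable_toLp 2 _).comp_aemeasurable (aemeasurable_pi_lambda _ fun j => ?_)
    have hm : Measurable fun p : (Fin J → Fin M → Finset (Fin n)) × (Fin n → 𝒵) =>
        validationLoss ℓ (g (lam j)) p.2 (p.1 j) :=
      measurable_from_prod_countable_right fun A => measurable_validationLoss (hmeas j) (A j)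
    exact ((hm.comp_aemeasurable
      ((hImeas n).aemeasurable.prodMk (hZ n).aemeasurable)).sub_const _).const_mul _
  have hcf (n : ℕ) (t : EuclideanSpace ℝ (Fin J)) : charFun ((P n).map fun ω =>
      WithLp.toLp 2 (fun j : Fin J => √n * (validationLoss ℓ (g (lam j)) (fun i => Z n i ω)
        (I n ω j) - expectedRisk ν ℓ (g (lam j)) n))) t
      = ∫ ω, Complex.exp (Complex.I
        * scaledError ν ℓ G (fun j => t j) (I n ω) (fun i => Z n i ω)) ∂(P n) := by
    rw [charFun_apply, integral_map (hX n) (by fun_prop)]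
    congr 1; ext ω
    rw [mul_comm]
    simp [hG, scaledError, PiLp.inner_apply]
  refine ⟨hX, aemeasurable_id, ?_⟩
  -- The filter is countably generated, so Lévy's theorem can be applied along sequences tending to
  -- it.
  refine tendsto_of_seq_tendsto fun u hu => ?_
  refine ProbabilityMeasure.tendsto_iff_tendsto_charFun.2 fun t => ?_
  have h := ((hchar (fun j => t j)).comp hu).congr fun k => (hcf (u k) t).symm
  simp only [ProbabilityMeasure.coe_mk, Measure.map_id]
  rw [charFun_multivariateGaussian hpsd, dotProduct_of_mulVec]
  have e : Complex.exp (-((∑ i, ∑ j, t i * t j * L i j : ℝ) : ℂ) / 2)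
      = Complex.exp ((inner ℝ t 0 : ℝ) * Complex.I
        - ((∑ i, ∑ j, t i * t j * (τ i j * K i j) : ℝ) : ℂ) / 2) := by
    simp only [inner_zero_right, Complex.ofReal_zero, zero_mul, zero_sub, neg_div, hL]
  exact e ▸ h
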